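/- Write $\{0,1\}^*$ for the set of finite binary strings and $|s|$ for the length of $s$. For $g\colon\mathbb{N}\to\mathbb{N}$ and $A,B\subset\{0,1\}^*$, say that $A$ is *reducible to $B$ in query size $g$* if there is an oracle deterministic Turing machine $M$ such that $A$ is Turing reducible to $B$ via $M$ and, on every input $x\in\{0,1\}^*$, $M$ (with oracle $B$) only queries strings of length at most $g(|x|)$. A *prefix-free machine* is a partial recursive function $F\colon\{0,1\}^*\to\{0,1\}^*$ whose domain $\operatorname{Dom}F$ is prefix-free, i.e. no string in it is a prefix of another string in it. A prefix-free machine $U$ is *optimal* if for every prefix-free machine $F$ there is $d\in\mathbb{N}$ such that for every $p\in\operatorname{Dom}F$ there is $q\in\operatorname{Dom}U$ with $U(q)=F(p)$ and $|q|\le|p|+d$. For an optimal prefix-free machine $V$ let $\Omega_V=\sum_{p\in\operatorname{Dom}V}2^{-|p|}$. For $\alpha\in\mathbb{R}$ let $\operatorname{Pf}(\alpha)=\{\alpha{\restriction}_n : n\in\mathbb{N}\}$, where $\alpha{\restriction}_n$ is the string of the first $n$ bits of the base-two expansion of $\alpha-\lfloor\alpha\rfloor$ with infinitely many zeros. An *order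 function* is a non-decreasing total recursive function $f\colon\mathbb{N}\to\mathbb{N}$ with $\lim_{n\to\infty}f(n)=\infty$. **Theorem.** Let $V$ and $W$ be optimal prefix-free machines, and let $f$ be an order function. Then the following two conditions are equivalent: (i) $\operatorname{Pf}(\Omega_V)$ is reducible to $\operatorname{Dom}W$ in query size $f(n)+O(1)$, i.e. there is $c\in\mathbb{N}$ such that $\operatorname{Pf}(\Omega_V)$ is reducible to $\operatorname{Dom}W$ in query size $n\mapsto f(n)+c$. (ii) $\sum_{n=0}^{\infty}2^{n-f(n)}<\infty$. -/

import Mathlib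

namespace QuerySize

/-- Programs for deterministic computation relative to an oracle `B ⊆ {0,1}*`: the programs
`Nat.Partrec.Code` of partial recursive functions together with one instruction `query`, which asks
the oracle about its current argument. Strings are handled through the numerical coding
`Encodable.encode : List Bool → ℕ`. These are indices for the functions recursive in `B`
(cf. `Nat.RecursiveIn`). -/
inductive OracleCode : Type
  | zero : OracleCode
  | succ : OracleCode
  | left : OracleCode
  | right : OracleCode
  | query : OracleCode
  | pair : OracleCode → OracleCode → OracleCode
  | comp : OracleCode → OracleCode → OracleCode
  | prec : OracleCode → OracleCode → OracleCode
  | rfind : OracleCode → OracleCode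

namespace OracleCode

open Classical in
/-- The oracle's answer to the query `n`: `1` if `n` codes a string in `B`, and `0` otherwise. -/
noncomputable def answer (B : Set (List Bool)) (n : ℕ) : ℕ :=
  if ∃ s ∈ B, Encodable.encode s = n then 1 else 0

/-- The partial function computed by a program with oracle `B`. -/
noncomputable def eval (B : Set (List Bool)) : OracleCode → ℕ →. ℕ
  | zero => fun _ => Part.some 0
  | succ => fun n => Part.some (n + 1)
  | left => fun n => Part.some n.unpair.1
  | right => fun n => Part.some n.unpair.2
  | query => fun n => Part.some (answer B n)
  | pair cf cg => fun n => (eval B cf n).bind fun u => (eval B cg n).map fun v => Nat.pair u v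
  | comp cf cg => fun n => (eval B cg n).bind (eval B cf)
  | prec cf cg => fun p =>
      Nat.rec (motive := fun _ => Part ℕ) (eval B cf p.unpair.1)
        (fun y r => r.bind fun i => eval B cg (Nat.pair p.unpair.1 (Nat.pair y i))) p.unpair.2
  | rfind cf => fun a => Nat.rfind fun n => (eval B cf (Nat.pair a n)).map fun m => decide (m = 0)

/-- `Queries B c n q`: in the course of its computation on input `n` with oracle `B`, the
program `c` puts the query `q` to the oracle. -/
inductive Queries (B : Set (List Bool)) : OracleCode → ℕ → ℕ → Prop
  | query (n : ℕ) : Queries B query n n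
  | pair_left {cf cg : OracleCode} {n q : ℕ} :
      Queries B cf n q → Queries B (pair cf cg) n q
  | pair_right {cf cg : OracleCode} {n q : ℕ} :
      (eval B cf n).Dom → Queries B cg n q → Queries B (pair cf cg) n q
  | comp_inner {cf cg : OracleCode} {n q : ℕ} :
      Queries B cg n q → Queries B (comp cf cg) n q
  | comp_outer {cf cg : OracleCode} {n y q : ℕ} :
      y ∈ eval B cg n → Queries B cf y q → Queries B (comp cf cg) n q
  | prec_base {cf cg : OracleCode} {a n q : ℕ} :
      Queries B cf a q → Queries B (prec cf cg) (Nat.pair a n) q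
  | prec_step {cf cg : OracleCode} {a n y i q : ℕ} :
      y < n → i ∈ eval B (prec cf cg) (Nat.pair a y) →
      Queries B cg (Nat.pair a (Nat.pair y i)) q → Queries B (prec cf cg) (Nat.pair a n) q
  | rfind {cf : OracleCode} {a m q : ℕ} :
      (∀ k < m, ∃ v ∈ eval B cf (Nat.pair a k), v ≠ 0) →
      Queries B cf (Nat.pair a m) q → Queries B (rfind cf) a q

end OracleCode

/-- `A` is Turing reducible to `B` via the oracle program `c`: with oracle `B`, on every input `x`
the program halts and decides whether `x ∈ A`. -/
def TuringReducibleVia (c : OracleCode) (A B : Set (List Bool)) : Prop :=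
  ∀ x : List Bool,
    (x ∈ A → 1 ∈ c.eval B (Encodable.encode x)) ∧ (x ∉ A → 0 ∈ c.eval B (Encodable.encode x))

/-- `A` is reducible to `B` in query size `f`: some oracle program reduces `A` to `B`, and
on every input `x` it only queries strings of length at most `f |x|`. -/
def ReducibleInQuerySize (f : ℕ → ℕ) (A B : Set (List Bool)) : Prop :=
  ∃ c : OracleCode, TuringReducibleVia c A B ∧
    ∀ x : List Bool, ∀ q : ℕ, c.Queries B (Encodable.encode x) q →
      ∃ s : List Bool, Encodable.encode s = q ∧ s.length ≤ f x.length

/-- No string in `S` is a prefix of another string in `S`. -/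
def PrefixFree (S : Set (List Bool)) : Prop :=
  ∀ s ∈ S, ∀ t ∈ S, s <+: t → s = t

/-- A prefix-free machine: a partial recursive function on strings with prefix-free domain. -/
structure PrefixFreeMachine (F : List Bool →. List Bool) : Prop where
  partrec : Partrec F
  prefixFree : PrefixFree F.Dom

/-- An optimal prefix-free machine: it simulates every prefix-free machine with constant overhead
in program length. -/
structure OptimalPrefixFreeMachine (U : List Bool →. List Bool) : Prop
    extends PrefixFreeMachine U where
  optimal : ∀ F : List Bool →. List Bool, PrefixFreeMachine F →
    ∃ d : ℕ, ∀ p s : List Bool, s ∈ F p → ∃ q : List Bool, s ∈ U q ∧ q.length ≤ p.length + d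

/-- The halting probability of `V`, the sum of `2 ^ (-|p|)` over all `p` in the domain of `V`. -/
noncomputable def Omega (V : List Bool →. List Bool) : ℝ :=
  ∑' p : V.Dom, (2 : ℝ) ^ (-((p : List Bool).length : ℤ))

/-- The first `n` bits of the base-two expansion with infinitely many zeros of the fractional part
of `α`; the bit of weight `2 ^ (-(i + 1))` is the parity of the floor of `2 ^ (i + 1)` times it. -/
noncomputable def bits (α : ℝ) (n : ℕ) : List Bool :=
  (List.range n).map fun i => decide (⌊(2 : ℝ) ^ (i + 1) * Int.fract α⌋ % 2 = 1)

/-- The set of all finite prefixes of the base-two expansion of `α`. -/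
def Pf (α : ℝ) : Set (List Bool) :=
  Set.range (bits α)

/-- An order function: non-decreasing, total recursive and tending to infinity. -/
structure OrderFunction (f : ℕ → ℕ) : Prop where
  monotone : Monotone f
  computable : Computable f
  tendsto : Filter.Tendsto f Filter.atTop Filter.atTop

end QuerySize

/-! Both directions weigh the growth of the approximations `Ω_s` from below to `Ω_V` against the
Kraft sum of programs.

(i) ⇒ (ii). Suppose the sum diverges although a reduction `M` exists. Call a stage consistent if
`M`, run with the part of `Dom W` enumerated so far, decides the prefixes of `Ω_s` of length at most
`N`. If `Ω_s` grows by `2^(-n)` between two consistent stages, its first `n` bits change, so the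
answers of `M` change, and a new string of length at most `f n` must have entered `Dom W`.
Optimality of `V` supplies the growth (`exists_forcing`): a machine printing strings that `V` has
not yet printed obliges `V` to halt on new programs. It is made to do so `2^(N-2d)` times, each
growth being at least `2^(-N)`, so about `2^(n-2d)` strings of length at most `f n` enter `Dom W`,
for every `n ≤ N` at once (`two_pow_le_length_progs`). Kraft's inequality for `W` then bounds the
sum of `2^(n-f n)` over `n ≤ N` by `8 * 2^(2d)` (`sum_le_of_two_pow_le_length_progs`), whereas `N`
was chosen to make it larger.

(ii) ⇒ (i). Convergence gives a computable prefix code `u` with `|u n| = f n - n + O(1)`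
(`exists_prefix_code`). A machine reading `u n` and then the first `n` bits of `Ω_V` finds a stage
`s` at which `Ω_s` has these bits and prints `s` in unary. By optimality `W` prints it from a
program of length at most `f n + O(1)`. Querying all strings up to that length, running those in
`Dom W`, and taking a stage beyond all output lengths therefore yields the correct bits. -/

namespace QuerySize

open Encodable Filter

/-! ### Stagewise enumeration of partial recursive functions. -/

section StageApprox

variable {α β : Type*} [Primcodable α] [Primcodable β]

/-- `G` enumerates the graph of the partial function `F` in primitive recursive stages. -/
structure StageApprox (F : α →. β) (G : ℕ → α → Option β) : Prop where
  primrec : Primrec₂ G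
  mono : ∀ {s t : ℕ} {a : α} {b : β}, s ≤ t → b ∈ G s a → b ∈ G t a
  mem_iff : ∀ {a : α} {b : β}, b ∈ F a ↔ ∃ s, b ∈ G s a

/-- Step-bounded evaluation of a code for `F` does this. Since the stages are total, every test
about a stage is decidable, which makes unbounded searches over stages partial recursive. -/
theorem exists_stageApprox {F : α →. β} (hF : Partrec F) : ∃ G, StageApprox F G := by
  obtain ⟨c, hc⟩ := Nat.Partrec.Code.exists_code.1 hF
  have hev : ∀ a : α, c.eval (encode a) = (F a).map encode := by
    intro a
    rw [hc]
    simp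
  refine ⟨fun s a => (Nat.Partrec.Code.evaln s c (encode a)).bind decode, ?_, ?_, ?_⟩
  · refine Primrec.option_bind (Nat.Partrec.Code.primrec_evaln.comp
      (((Primrec.fst).pair (Primrec.const c)).pair (Primrec.encode.comp Primrec.snd))) ?_
    exact Primrec.decode.comp Primrec.snd
  · intro s t a b hst hb
    simp only [Option.mem_def, Option.bind_eq_some_iff] at hb ⊢
    obtain ⟨x, hx, hxb⟩ := hb
    exact ⟨x, Nat.Partrec.Code.evaln_mono hst hx, hxb⟩
  · intro a b
    constructor
    · intro hb
      have : encode b ∈ c.eval (encode a) := by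
        rw [hev]
        exact Part.mem_map _ hb
      obtain ⟨s, hs⟩ := Nat.Partrec.Code.evaln_complete.1 this
      refine ⟨s, ?_⟩
      simp only [Option.mem_def, Option.bind_eq_some_iff]
      exact ⟨_, hs, encodek b⟩
    · rintro ⟨s, hs⟩
      simp only [Option.mem_def, Option.bind_eq_some_iff] at hs
      obtain ⟨x, hx, hxb⟩ := hs
      have := Nat.Partrec.Code.evaln_sound hx
      rw [hev, Part.mem_map_iff] at this
      obtain ⟨b', hb', rfl⟩ := this
      rw [encodek] at hxb
      cases hxb
      exact hb'

theorem StageApprox.dom_iff {F : α →. β} {G : ℕ → α → Option β} (h : StageApprox F G) {a : α} :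
    a ∈ F.Dom ↔ ∃ s, (G s a).isSome := by
  rw [PFun.mem_dom]
  constructor
  · rintro ⟨y, hy⟩
    obtain ⟨s, hs⟩ := h.mem_iff.1 hy
    exact ⟨s, Option.isSome_iff_exists.2 ⟨y, hs⟩⟩
  · rintro ⟨s, hs⟩
    obtain ⟨y, hy⟩ := Option.isSome_iff_exists.1 hs
    exact ⟨y, h.mem_iff.2 ⟨s, hy⟩⟩

theorem StageApprox.isSome_mono {F : α →. β} {G : ℕ → α → Option β} (h : StageApprox F G)
    {s t : ℕ} (hst : s ≤ t) {a : α} (ha : (G s a).isSome) : (G t a).isSome := by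
  obtain ⟨y, hy⟩ := Option.isSome_iff_exists.1 ha
  exact Option.isSome_iff_exists.2 ⟨y, h.mono hst hy⟩

end StageApprox

/-! ### Computability of elementary operations on lists and sums. -/

section Primrec

variable {α : Type*} [Primcodable α]

theorem primrec_nat_pow : Primrec₂ ((· ^ ·) : ℕ → ℕ → ℕ) :=
  Primrec₂.unpaired'.1 Nat.Primrec.pow

theorem primrec_list_sum : Primrec (List.sum : List ℕ → ℕ) :=
  (Primrec.list_foldr Primrec.id (Primrec.const 0)
    (Primrec.nat_add.comp (Primrec.fst.comp Primrec.snd) (Primrec.snd.comp Primrec.snd)).to₂).of_eq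
    fun l => by simp [List.sum]

theorem primrec_filter {β : Type*} [Primcodable β] {f : α → List β} {p : α → β → Bool}
    (hf : Primrec f) (hp : Primrec₂ p) : Primrec fun a => (f a).filter (p a) := by
  have : Primrec fun a => (f a).filterMap fun b => cond (p a b) (some b) none :=
    Primrec.listFilterMap hf (Primrec.cond hp (Primrec.option_some.comp Primrec.snd)
      (Primrec.const none))
  refine this.of_eq fun a => ?_
  induction f a with
  | nil => rfl
  | cons b l ih => cases h : p a b <;> simp [h, ih]

theorem primrec_all {β : Type*} [Primcodable β] {f : α → List β} {p : α → β → Bool}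
    (hf : Primrec f) (hp : Primrec₂ p) : Primrec fun a => (f a).all (p a) := by
  have : Primrec fun a => (f a).foldr (fun b r => p a b && r) true :=
    Primrec.list_foldr hf (Primrec.const true)
      (Primrec.and.comp (hp.comp Primrec.fst (Primrec.fst.comp Primrec.snd))
        (Primrec.snd.comp Primrec.snd)).to₂
  refine this.of_eq fun a => ?_
  induction f a with
  | nil => rfl
  | cons b l ih => simp [ih]

theorem primrec_replicate {β : Type*} [Primcodable β] (b : β) :
    Primrec fun n : ℕ => List.replicate n b :=
  (Primrec.list_map Primrec.list_range (Primrec.const b).to₂).of_eq fun n => by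
    simp

theorem computable_sum {f : ℕ → ℕ → ℕ} (hf : Computable₂ f) :
    Computable₂ fun a n : ℕ => ∑ i ∈ Finset.range n, f a i := by
  have : Computable fun p : ℕ × ℕ =>
      (Nat.rec 0 (fun i r => r + f p.1 i) p.2 : ℕ) :=
    Computable.nat_rec Computable.snd (Computable.const 0)
      ((Primrec.nat_add.to_comp).comp (Computable.snd.comp Computable.snd)
        (hf.comp (Computable.fst.comp Computable.fst) (Computable.fst.comp Computable.snd))).to₂
  refine this.of_eq fun p => ?_
  induction p.2 with
  | zero => simp
  | succ n ih => simp [Finset.sum_range_succ, ih]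

theorem computable_map_range {f : ℕ → ℕ} (hf : Computable f) :
    Computable fun n : ℕ => (List.range n).map f := by
  have : Computable fun n : ℕ => (Nat.rec [] (fun i r => r ++ [f i]) n : List ℕ) :=
    Computable.nat_rec Computable.id (Computable.const [])
      (Computable.list_concat.comp (Computable.snd.comp Computable.snd)
        (hf.comp (Computable.fst.comp Computable.snd))).to₂
  refine this.of_eq fun n => ?_
  induction n with
  | zero => simp
  | succ n ih => simp [List.range_succ, ih]

end Primrec

/-! ### Finite stages of a machine, and binary digits as floors. -/

/-- All binary strings of length at most `k`. -/
def stringsUpTo : ℕ → List (List Bool)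
  | 0 => [[]]
  | k + 1 => [] :: ((stringsUpTo k).map (List.cons true) ++ (stringsUpTo k).map (List.cons false))

theorem mem_stringsUpTo {k : ℕ} {x : List Bool} : x ∈ stringsUpTo k ↔ x.length ≤ k := by
  induction k generalizing x with
  | zero => simp [stringsUpTo]
  | succ k ih =>
    rcases x with _ | ⟨b, x⟩
    · simp [stringsUpTo]
    · cases b <;> simp [stringsUpTo, ih]

theorem nodup_stringsUpTo (k : ℕ) : (stringsUpTo k).Nodup := by
  induction k with
  | zero => simp [stringsUpTo]
  | succ k ih =>
    simp only [stringsUpTo, List.nodup_cons, List.mem_append, List.mem_map, List.nodup_append]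
    refine ⟨by simp, ih.map (List.cons_injective), ih.map (List.cons_injective), ?_⟩
    rintro _ ⟨x, -, rfl⟩ _ ⟨y, -, rfl⟩
    simp

theorem primrec_stringsUpTo : Primrec stringsUpTo := by
  have h : ∀ b : Bool, Primrec fun p : ℕ × List (List Bool) => p.2.map (List.cons b) := fun b =>
    Primrec.list_map Primrec.snd (Primrec.list_cons.comp (Primrec.const b) Primrec.snd)
  have : Primrec (Nat.rec [[]] (fun _ L => [] :: (L.map (List.cons true) ++
      L.map (List.cons false))) : ℕ → List (List Bool)) :=
    Primrec.nat_rec₁ _ (Primrec.list_cons.comp (Primrec.const [])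
      (Primrec.list_append.comp (h true) (h false)))
  refine this.of_eq fun k => ?_
  induction k with
  | zero => rfl
  | succ k ih => simp only [stringsUpTo, ← ih]

/-- The strings of length at most `k` on which the machine enumerated by `G` halts by stage `s`. -/
def progs (G : ℕ → List Bool → Option (List Bool)) (s k : ℕ) : List (List Bool) :=
  (stringsUpTo k).filter fun p => (G s p).isSome

theorem primrec_progs {G : ℕ → List Bool → Option (List Bool)} (hG : Primrec₂ G) :
    Primrec₂ (progs G) :=
  primrec_filter (primrec_stringsUpTo.comp Primrec.snd)
    (Primrec.option_isSome.comp (hG.comp (Primrec.fst.comp Primrec.fst) Primrec.snd)).to₂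

theorem mem_progs {G : ℕ → List Bool → Option (List Bool)} {s k : ℕ} {p : List Bool} :
    p ∈ progs G s k ↔ p.length ≤ k ∧ (G s p).isSome := by
  simp [progs, mem_stringsUpTo]

theorem nodup_progs (G : ℕ → List Bool → Option (List Bool)) (s k : ℕ) : (progs G s k).Nodup :=
  (nodup_stringsUpTo k).filter _

/-- The numerator over `2 ^ s` of the stage `s` approximation to the halting probability. -/
def omegaNum (G : ℕ → List Bool → Option (List Bool)) (s : ℕ) : ℕ :=
  ((progs G s s).map fun p => 2 ^ (s - p.length)).sum

theorem primrec_omegaNum {G : ℕ → List Bool → Option (List Bool)} (hG : Primrec₂ G) :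
    Primrec (omegaNum G) :=
  primrec_list_sum.comp (Primrec.list_map ((primrec_progs hG).comp Primrec.id Primrec.id)
    (primrec_nat_pow.comp (Primrec.const 2)
      (Primrec.nat_sub.comp Primrec.fst (Primrec.list_length.comp Primrec.snd))).to₂)

/-- The first `n` bits of the base-two expansion of `a / 2 ^ e`. -/
def dyadicBits (a e n : ℕ) : List Bool :=
  (List.range n).map fun i => decide (2 ^ (i + 1) * a / 2 ^ e % 2 = 1)

theorem primrec_dyadicBits : Primrec fun p : (ℕ × ℕ) × ℕ => dyadicBits p.1.1 p.1.2 p.2 := by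
  refine Primrec.list_map (Primrec.list_range.comp Primrec.snd) ?_
  have hp : Primrec fun q : ((ℕ × ℕ) × ℕ) × ℕ => 2 ^ (q.2 + 1) * q.1.1.1 / 2 ^ q.1.1.2 % 2 :=
    Primrec.nat_mod.comp (Primrec.nat_div.comp (Primrec.nat_mul.comp
      (primrec_nat_pow.comp (Primrec.const 2) (Primrec.succ.comp Primrec.snd))
      (Primrec.fst.comp (Primrec.fst.comp Primrec.fst)))
      (primrec_nat_pow.comp (Primrec.const 2)
        (Primrec.snd.comp (Primrec.fst.comp Primrec.fst)))) (Primrec.const 2)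
  exact Primrec.eq.decide.comp hp (Primrec.const 1)

theorem bits_dyadic {a e : ℕ} (h : a < 2 ^ e) (n : ℕ) :
    bits ((a : ℝ) / 2 ^ e) n = dyadicBits a e n := by
  have hfr : Int.fract ((a : ℝ) / 2 ^ e) = (a : ℝ) / 2 ^ e := by
    rw [Int.fract_eq_self]
    refine ⟨by positivity, ?_⟩
    rw [div_lt_one (by positivity)]
    exact_mod_cast h
  unfold bits dyadicBits
  rw [hfr]
  refine List.map_congr_left fun i _ => ?_
  have : ⌊(2 : ℝ) ^ (i + 1) * ((a : ℝ) / 2 ^ e)⌋ = ((2 ^ (i + 1) * a / 2 ^ e : ℕ) : ℤ) := by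
    rw [← mul_div_assoc]
    rw [← Nat.floor_div_eq_div (K := ℝ), Int.natCast_floor_eq_floor (by positivity)]
    push_cast
    rfl
  rw [this]
  congr 1
  apply propext
  omega

@[simp] theorem length_bits (α : ℝ) (n : ℕ) : (bits α n).length = n := by simp [bits]

theorem bits_succ (α : ℝ) (n : ℕ) : bits α (n + 1) =
    bits α n ++ [decide (⌊(2 : ℝ) ^ (n + 1) * Int.fract α⌋ % 2 = 1)] := by
  simp [bits, List.range_succ]

theorem bits_prefix (α : ℝ) {m n : ℕ} (h : m ≤ n) : bits α m <+: bits α n := by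
  induction n, h using Nat.le_induction with
  | base => exact List.prefix_rfl
  | succ n _ ih => exact ih.trans (by rw [bits_succ]; exact List.prefix_append _ _)

theorem floor_two_pow_succ (x : ℝ) (n : ℕ) :
    ⌊(2 : ℝ) ^ (n + 1) * x⌋ / 2 = ⌊(2 : ℝ) ^ n * x⌋ := by
  have := Int.floor_div_natCast ((2 : ℝ) ^ (n + 1) * x) 2
  push_cast at this
  rw [← this, pow_succ]
  congr 1
  ring

/-- The last bit is the parity of the floor, and halving the floor drops that bit, so the first `n`
bits and the floor determine each other. This turns statements about prefixes into inequalities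
between reals. -/
theorem bits_eq_iff_fract {x y : ℝ} {n : ℕ} :
    bits x n = bits y n ↔ ⌊(2 : ℝ) ^ n * Int.fract x⌋ = ⌊(2 : ℝ) ^ n * Int.fract y⌋ := by
  induction n with
  | zero => simp [bits]
  | succ n ih =>
    have hx := floor_two_pow_succ (Int.fract x) n
    have hy := floor_two_pow_succ (Int.fract y) n
    have happ : ∀ a b : Bool, bits x n ++ [a] = bits y n ++ [b] ↔ bits x n = bits y n ∧ a = b :=
      fun a b => ⟨fun h => by simpa using List.append_inj h (by simp), by rintro ⟨h, rfl⟩; rw [h]⟩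
    rw [bits_succ, bits_succ, happ, ih, ← hx, ← hy, decide_eq_decide]
    omega

theorem bits_eq_iff {x y : ℝ} {n : ℕ} (hx : x ∈ Set.Ico (0 : ℝ) 1) (hy : y ∈ Set.Ico (0 : ℝ) 1) :
    bits x n = bits y n ↔ ⌊(2 : ℝ) ^ n * x⌋ = ⌊(2 : ℝ) ^ n * y⌋ := by
  rw [bits_eq_iff_fract, Int.fract_eq_self.2 ⟨hx.1, hx.2⟩, Int.fract_eq_self.2 ⟨hy.1, hy.2⟩]

theorem mem_Pf_iff {α : ℝ} {x : List Bool} : x ∈ Pf α ↔ x = bits α x.length := by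
  constructor
  · rintro ⟨n, rfl⟩
    simp
  · intro h
    exact ⟨_, h.symm⟩

end QuerySize

/-! ### Kraft's inequality and the approximation of `Ω` from below. -/

namespace QuerySize

open Encodable

/-- The measure `2 ^ (-|p|)` of a program `p`. -/
noncomputable def weight (p : List Bool) : ℝ := (2 : ℝ) ^ (-(p.length : ℤ))

theorem weight_pos (p : List Bool) : 0 < weight p := by unfold weight; positivity

/-- Of two factorizations of one string, the first words are comparable prefixes, hence equal, and
can be cancelled. The empty word could be inserted at will, so it is excluded; a prefix-free set
containing it is a singleton. -/
theorem PrefixFree.uniquelyDecodable {S : Set (List Bool)} (hS : PrefixFree S) (h : [] ∉ S) :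
    InformationTheory.UniquelyDecodable S := by
  intro L₁
  induction L₁ with
  | nil =>
    intro L₂ _ h₂ he
    rcases L₂ with _ | ⟨w, L₂⟩
    · rfl
    · have : w = [] := by
        have := he.symm
        simp only [List.flatten_cons, List.flatten_nil, List.append_eq_nil_iff] at this
        exact this.1
      exact absurd (this ▸ h₂ w (by simp)) h
  | cons v L₁ ih =>
    intro L₂ h₁ h₂ he
    rcases L₂ with _ | ⟨w, L₂⟩
    · have : v = [] := by
        simp only [List.flatten_cons, List.flatten_nil, List.append_eq_nil_iff] at he
        exact he.1
      exact absurd (this ▸ h₁ v (by simp)) h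
    · simp only [List.flatten_cons] at he
      have hv := h₁ v (by simp)
      have hw := h₂ w (by simp)
      have hvw : v = w := by
        rcases List.prefix_or_prefix_of_prefix (List.prefix_append v L₁.flatten)
          (he ▸ List.prefix_append w L₂.flatten) with hp | hp
        · exact hS _ hv _ hw hp
        · exact (hS _ hw _ hv hp).symm
      subst hvw
      rw [ih L₂ (fun x hx => h₁ x (by simp [hx])) (fun x hx => h₂ x (by simp [hx]))
        (List.append_cancel_left he)]

theorem PrefixFree.mono {S T : Set (List Bool)} (hT : PrefixFree T) (h : S ⊆ T) : PrefixFree S :=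
  fun s hs t ht => hT s (h hs) t (h ht)

theorem PrefixFree.sum_weight_le_one {S : Finset (List Bool)}
    (hS : PrefixFree (S : Set (List Bool))) : ∑ p ∈ S, weight p ≤ 1 := by
  by_cases h : [] ∈ S
  · have : S = {[]} := by
      ext x
      simp only [Finset.mem_singleton]
      exact ⟨fun hx => (hS [] h x hx List.nil_prefix).symm, by rintro rfl; exact h⟩
    simp [this, weight]
  · refine le_trans (le_of_eq ?_)
      (InformationTheory.kraft_mcmillan_inequality (hS.uniquelyDecodable h))
    refine Finset.sum_congr rfl fun p _ => ?_
    simp [weight]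

theorem PrefixFree.summable_weight {S : Set (List Bool)} (hS : PrefixFree S) :
    Summable fun p : S => weight p := by
  refine summable_of_sum_le (c := 1) (fun p => (weight_pos _).le) fun u => ?_
  have := PrefixFree.sum_weight_le_one (S := u.map (Function.Embedding.subtype _))
    (hS.mono (by simp))
  simpa using this

section Omega

variable {V : List Bool →. List Bool} {G : ℕ → List Bool → Option (List Bool)}

/-- The stage `s` approximation to the halting probability. -/
noncomputable def omegaApprox (G : ℕ → List Bool → Option (List Bool)) (s : ℕ) : ℝ :=
  (omegaNum G s : ℝ) / 2 ^ s

theorem omegaApprox_eq (s : ℕ) : omegaApprox G s = ∑ p ∈ (progs G s s).toFinset, weight p := by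
  rw [List.sum_toFinset _ (nodup_progs _ _ _), omegaApprox, omegaNum]
  have : ∀ l : List (List Bool), (∀ p ∈ l, p.length ≤ s) →
      (((l.map fun p => 2 ^ (s - p.length)).sum : ℕ) : ℝ) / 2 ^ s = (l.map weight).sum := by
    intro l
    induction l with
    | nil => simp
    | cons p l ih =>
      intro h
      have hp := h p (by simp)
      rw [List.map_cons, List.map_cons, List.sum_cons, List.sum_cons,
        ← ih fun q hq => h q (by simp [hq])]
      push_cast
      rw [add_div]
      congr 1
      rw [weight, zpow_neg, zpow_natCast, div_eq_iff (by positivity), eq_comm, inv_mul_eq_iff_eq_mul₀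
        (by positivity), ← pow_add]
      congr 1
      omega
  exact this _ fun p hp => (mem_progs.1 hp).1

theorem PrefixFree.sum_le_omega (hV : PrefixFree V.Dom) {S : Finset (List Bool)}
    (hS : (S : Set (List Bool)) ⊆ V.Dom) : ∑ p ∈ S, weight p ≤ Omega V := by
  have hinj : Function.Injective fun p : S => (⟨p.1, hS p.2⟩ : V.Dom) := fun a b h =>
    Subtype.ext (congrArg (fun x : V.Dom => (x : List Bool)) h)
  have h := hV.summable_weight.sum_le_tsum (S.attach.map ⟨_, hinj⟩)
    (fun _ _ => (weight_pos _).le)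
  rw [Finset.sum_map] at h
  rw [← Finset.sum_attach S weight]
  exact h

theorem StageApprox.progs_subset (hG : StageApprox V G) (s k : ℕ) :
    ((progs G s k).toFinset : Set (List Bool)) ⊆ V.Dom := by
  intro p hp
  exact hG.dom_iff.2 ⟨s, (mem_progs.1 (List.mem_toFinset.1 hp)).2⟩

theorem StageApprox.omegaApprox_mono (hG : StageApprox V G) : Monotone (omegaApprox G) := by
  intro s t hst
  rw [omegaApprox_eq, omegaApprox_eq]
  refine Finset.sum_le_sum_of_subset_of_nonneg (fun p hp => ?_) fun p _ _ => (weight_pos p).le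
  rw [List.mem_toFinset, mem_progs] at hp ⊢
  exact ⟨hp.1.trans hst, hG.isSome_mono hst hp.2⟩

theorem StageApprox.omegaApprox_le (hG : StageApprox V G) (hV : PrefixFree V.Dom) (s : ℕ) :
    omegaApprox G s ≤ Omega V := by
  rw [omegaApprox_eq]
  exact hV.sum_le_omega (hG.progs_subset s s)

theorem StageApprox.omegaApprox_add_le (hG : StageApprox V G) (hV : PrefixFree V.Dom) {s : ℕ}
    {q : List Bool} (hq : q ∈ V.Dom) (hqs : q ∉ progs G s s) :
    omegaApprox G s + weight q ≤ Omega V := by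
  rw [omegaApprox_eq, add_comm, ← Finset.sum_insert (by simpa using hqs)]
  refine hV.sum_le_omega ?_
  rw [Finset.coe_insert]
  exact Set.insert_subset hq (hG.progs_subset s s)

theorem StageApprox.exists_lt_omegaApprox (hG : StageApprox V G) (hV : PrefixFree V.Dom) {r : ℝ}
    (hr : r < Omega V) : ∃ s, r < omegaApprox G s := by
  obtain ⟨u, hu⟩ := ((hV.summable_weight.hasSum).eventually_const_lt hr).exists
  have : ∃ s, ∀ p ∈ u, (p : List Bool) ∈ progs G s s := by
    clear hu
    induction u using Finset.induction_on with
    | empty => exact ⟨0, by simp⟩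
    | insert p u _ ih =>
      obtain ⟨s, hs⟩ := ih
      obtain ⟨t, ht⟩ := hG.dom_iff.1 p.2
      refine ⟨max (max s t) (p : List Bool).length, fun q hq => ?_⟩
      rw [mem_progs]
      rcases Finset.mem_insert.1 hq with rfl | hq
      · exact ⟨by simp, hG.isSome_mono (by simp) ht⟩
      · have := mem_progs.1 (hs q hq)
        exact ⟨this.1.trans (by simp), hG.isSome_mono (by simp) this.2⟩
  obtain ⟨s, hs⟩ := this
  refine ⟨s, hu.trans_le ?_⟩
  rw [omegaApprox_eq]
  refine (Finset.sum_map u (Function.Embedding.subtype _) weight).ge.trans ?_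
  refine Finset.sum_le_sum_of_subset_of_nonneg (fun p hp => ?_) fun p _ _ => (weight_pos p).le
  rw [Finset.mem_map] at hp
  obtain ⟨q, hq, rfl⟩ := hp
  exact List.mem_toFinset.2 (hs q hq)

theorem PrefixFree.omega_le_one (hV : PrefixFree V.Dom) : Omega V ≤ 1 :=
  hV.summable_weight.tsum_le_of_sum_le fun u => by
    have := PrefixFree.sum_weight_le_one (S := u.map (Function.Embedding.subtype _))
      (hV.mono (by simp))
    simpa using this

theorem omega_nonneg : 0 ≤ Omega V := tsum_nonneg fun _ => by positivity

end Omega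

/-- A computable family of prefix-free tags, each followed by an argument of prescribed length,
gives rise to a prefix-free machine. -/
theorem exists_tagged_machine {w : ℕ → List Bool} (hw : Computable w)
    (hwp : ∀ m n, w m <+: w n → m = n) {l : ℕ → ℕ} (hl : Computable l)
    {g : ℕ → List Bool →. List Bool} (hg : Partrec₂ g) :
    ∃ F, PrefixFreeMachine F ∧
      ∀ n v x, v.length = l n → x ∈ g n v → x ∈ F (w n ++ v) := by
  classical
  -- `k` ranges over codes of candidate factorizations `p = w n ++ v`. The tag and the prescribed
  -- length of `v` make the factorization unique, so the search has at most one result.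
  set sel : List Bool → ℕ → Option (ℕ × List Bool) := fun p k =>
    (decode k : Option (ℕ × List Bool)).bind fun a =>
      cond (decide (a.2.length = l a.1) && decide (w a.1 ++ a.2 = p)) (some a) none with hsel
  have hselc : Computable₂ sel := by
    refine Computable.option_bind (Computable.decode.comp Computable.snd) ?_
    have ha : Computable fun q : (List Bool × ℕ) × ℕ × List Bool => q.2.1 :=
      Computable.fst.comp Computable.snd
    have hb : Computable fun q : (List Bool × ℕ) × ℕ × List Bool => q.2.2 :=
      Computable.snd.comp Computable.snd
    have h1 : Computable fun q : (List Bool × ℕ) × ℕ × List Bool =>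
        decide (q.2.2.length = l q.2.1) :=
      Primrec.eq.decide.to_comp.comp (Computable.list_length.comp hb) (hl.comp ha)
    have h2 : Computable fun q : (List Bool × ℕ) × ℕ × List Bool =>
        decide (w q.2.1 ++ q.2.2 = q.1.1) :=
      Primrec.eq.decide.to_comp.comp (Computable.list_append.comp (hw.comp ha) hb)
        (Computable.fst.comp Computable.fst)
    exact Computable.cond (Primrec.and.to_comp.comp h1 h2)
      (Computable.option_some.comp Computable.snd) (Computable.const none)
  have hsel_mem : ∀ p k a, a ∈ sel p k → a.2.length = l a.1 ∧ w a.1 ++ a.2 = p := by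
    intro p k a h
    simp only [hsel, Option.mem_def, Option.bind_eq_some_iff] at h
    obtain ⟨b, -, hb⟩ := h
    rw [Bool.cond_eq_ite] at hb
    split_ifs at hb with hc
    cases hb
    simpa using hc
  have huniq : ∀ a b : ℕ × List Bool, a.2.length = l a.1 → b.2.length = l b.1 →
      w a.1 ++ a.2 <+: w b.1 ++ b.2 → a = b := by
    rintro ⟨m, u⟩ ⟨n, v⟩ hu hv hp
    have hmn : m = n := by
      rcases List.prefix_or_prefix_of_prefix ((List.prefix_append (w m) u).trans hp)
        (List.prefix_append (w n) v) with h | h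
      · exact hwp _ _ h
      · exact (hwp _ _ h).symm
    simp only at hu hv hp
    subst hmn
    rw [List.prefix_append_right_inj] at hp
    rw [hp.eq_of_length (hu.trans hv.symm)]
  refine ⟨fun p => (Nat.rfindOpt (sel p)).bind fun a => g a.1 a.2, ⟨?_, ?_⟩, ?_⟩
  · exact (Partrec.rfindOpt hselc).bind (hg.comp (Computable.fst.comp Computable.snd)
      (Computable.snd.comp Computable.snd))
  · have hdom : ∀ p, p ∈ PFun.Dom (fun p => (Nat.rfindOpt (sel p)).bind fun a => g a.1 a.2) →
        ∃ a : ℕ × List Bool, a.2.length = l a.1 ∧ w a.1 ++ a.2 = p := by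
      intro p hp
      obtain ⟨y, hy⟩ := (PFun.mem_dom _ _).1 hp
      obtain ⟨a, ha, -⟩ := Part.mem_bind_iff.1 hy
      obtain ⟨k, hk⟩ := Nat.rfindOpt_spec ha
      exact ⟨a, hsel_mem _ _ _ hk⟩
    intro p hp q hq hpq
    obtain ⟨a, ha, rfl⟩ := hdom p hp
    obtain ⟨b, hb, rfl⟩ := hdom q hq
    rw [huniq a b ha hb hpq]
  · intro n v x hv hx
    have hd : (Nat.rfindOpt (sel (w n ++ v))).Dom := by
      rw [Nat.rfindOpt_dom]
      refine ⟨encode (n, v), (n, v), ?_⟩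
      simp only [hsel, encodek]
      simp [hv]
    obtain ⟨a, ha⟩ := Part.dom_iff_mem.1 hd
    obtain ⟨k, hk⟩ := Nat.rfindOpt_spec ha
    obtain ⟨h1, h2⟩ := hsel_mem _ _ _ hk
    have : a = (n, v) := huniq _ _ h1 hv (by rw [h2])
    subst this
    exact Part.mem_bind_iff.2 ⟨_, ha, hx⟩

end QuerySize

/-! ### Forcing `Ω` to grow, and the stabilization of its bits. -/

namespace QuerySize

open Encodable

/-- The number written in binary, least significant bit first, by a string. -/
def bitsVal (v : List Bool) : ℕ := v.foldr (fun b r => 2 * r + b.toNat) 0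

theorem primrec_bitsVal : Primrec bitsVal :=
  Primrec.list_foldr Primrec.id (Primrec.const 0)
    (Primrec.nat_add.comp
      (Primrec.nat_mul.comp (Primrec.const 2) (Primrec.snd.comp Primrec.snd))
      ((Primrec.dom_bool Bool.toNat).comp (Primrec.fst.comp Primrec.snd))).to₂

theorem exists_bitsVal_eq {l i : ℕ} (h : i < 2 ^ l) : ∃ v, v.length = l ∧ bitsVal v = i := by
  induction l generalizing i with
  | zero => exact ⟨[], rfl, by simp at h; simp [h, bitsVal]⟩
  | succ l ih =>
    obtain ⟨v, hv, hi⟩ := ih (i := i / 2) (by rw [pow_succ] at h; omega)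
    refine ⟨decide (i % 2 = 1) :: v, by simp [hv], ?_⟩
    have : bitsVal (decide (i % 2 = 1) :: v) = 2 * bitsVal v + (decide (i % 2 = 1)).toNat := rfl
    rw [this, hi]
    rcases Nat.mod_two_eq_zero_or_one i with h | h <;> simp [h] <;> omega

/-- The number `n` in unary, terminated by `false`. -/
def unaryTag (n : ℕ) : List Bool := List.replicate n true ++ [false]

theorem unaryTag_prefix {m n : ℕ} (h : unaryTag m <+: unaryTag n) : m = n := by
  induction m generalizing n with
  | zero =>
    rcases n with _ | n
    · rfl
    · simp [unaryTag, List.replicate_succ] at h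
  | succ m ih =>
    rcases n with _ | n
    · simp [unaryTag, List.replicate_succ] at h
    · simp only [unaryTag, List.replicate_succ, List.cons_append, List.cons_prefix_cons,
        true_and] at h
      rw [ih h]

theorem computable_unaryTag : Computable unaryTag :=
  (Primrec.list_append.comp (primrec_replicate true) (Primrec.const _)).to_comp

variable {V : List Bool →. List Bool} {G : ℕ → List Bool → Option (List Bool)}

/-- A string which is not an output produced by stage `s` by programs of length at most `s`. -/
def freshOutput (G : ℕ → List Bool → Option (List Bool)) (s : ℕ) : List Bool :=
  List.replicate (((progs G s s).map fun p => ((G s p).getD []).length).sum + 1) true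

theorem primrec_freshOutput (hG : Primrec₂ G) : Primrec (freshOutput G) := by
  refine (primrec_replicate true).comp (Primrec.succ.comp (primrec_list_sum.comp
    (Primrec.list_map ((primrec_progs hG).comp Primrec.id Primrec.id) ?_)))
  exact Primrec.list_length.comp (Primrec.option_getD.comp hG (Primrec.const []))

theorem StageApprox.not_mem_progs_of_freshOutput (hG : StageApprox V G) {s : ℕ} {q : List Bool}
    (hq : freshOutput G s ∈ V q) : q ∉ progs G s s := by
  intro h
  obtain ⟨y, hy⟩ := Option.isSome_iff_exists.1 (mem_progs.1 h).2
  have := Part.mem_unique hq (hG.mem_iff.2 ⟨s, hy⟩)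
  -- A fresh output is one symbol longer than all earlier outputs together, so it differs from each
  -- of them.
  have hle : y.length ≤ ((progs G s s).map fun p => ((G s p).getD []).length).sum :=
    List.single_le_sum (by simp) _ (List.mem_map.2 ⟨q, h, by rw [hy]; rfl⟩)
  rw [← this, freshOutput, List.length_replicate] at hle
  omega

/-- An optimal machine can be forced to increase its halting probability at prescribed stages: the
`i`-th request of strategy `d`, placed at stage `s ∈ σ d i`, makes it grow by a fixed amount. -/
theorem OptimalPrefixFreeMachine.exists_forcing (hV : OptimalPrefixFreeMachine V)
    (hG : StageApprox V G) {l : ℕ → ℕ} (hl : Computable l) {σ : ℕ → ℕ →. ℕ} (hσ : Partrec₂ σ) :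
    ∃ e : ℕ, ∀ d i s, i < 2 ^ l d → s ∈ σ d i →
      omegaApprox G s + (2 : ℝ) ^ (-((e + d + l d : ℕ) : ℤ)) ≤ Omega V := by
  have hg : Partrec₂ fun d (v : List Bool) => (σ d (bitsVal v)).map (freshOutput G) :=
    Partrec.map (hσ.comp Computable.fst (primrec_bitsVal.to_comp.comp Computable.snd))
      ((primrec_freshOutput hG.primrec).to_comp.comp Computable.snd)
  obtain ⟨F, hF, hFg⟩ := exists_tagged_machine computable_unaryTag (fun _ _ => unaryTag_prefix)
    hl hg
  obtain ⟨e, he⟩ := hV.optimal F hF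
  -- The extra 1 pays for the terminator of the unary tag: the request has length `d + 1 + l d`.
  refine ⟨e + 1, fun d i s hi hs => ?_⟩
  obtain ⟨v, hv, rfl⟩ := exists_bitsVal_eq hi
  obtain ⟨q, hq, hlen⟩ := he _ _ (hFg d v _ hv (Part.mem_map _ hs))
  refine le_trans ?_ (hG.omegaApprox_add_le hV.prefixFree ((PFun.mem_dom _ _).2 ⟨_, hq⟩)
    (hG.not_mem_progs_of_freshOutput hq))
  refine add_le_add le_rfl (zpow_le_zpow_right₀ one_le_two ?_)
  simp [unaryTag, hv] at hlen
  omega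

/-- The halting probability of an optimal machine is not a dyadic rational. -/
theorem OptimalPrefixFreeMachine.omega_ne_dyadic (hV : OptimalPrefixFreeMachine V) (a b : ℕ) :
    Omega V ≠ (a : ℝ) / 2 ^ b := by
  intro hab
  obtain ⟨G, hG⟩ := exists_stageApprox hV.partrec
  -- If `Ω` were `a / 2 ^ b`, a stage within `2^(-2d)` of it could be found effectively. A request
  -- placed there with `d = e` and `l = 0` forces growth by `2^(-2e)`, pushing past `Ω`.
  set σ : ℕ → ℕ →. ℕ := fun d _ => Nat.rfind fun s =>
    Part.some (decide (a * 2 ^ s * 2 ^ (2 * d) < (omegaNum G s * 2 ^ (2 * d) + 2 ^ s) * 2 ^ b))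
    with hσ
  have hσc : Partrec₂ σ := by
    refine Partrec.rfind (Computable.partrec ?_)
    have hs : Primrec fun q : (ℕ × ℕ) × ℕ => 2 ^ q.2 :=
      primrec_nat_pow.comp (Primrec.const 2) Primrec.snd
    have hd : Primrec fun q : (ℕ × ℕ) × ℕ => 2 ^ (2 * q.1.1) :=
      primrec_nat_pow.comp (Primrec.const 2)
        (Primrec.nat_mul.comp (Primrec.const 2) (Primrec.fst.comp Primrec.fst))
    exact (Primrec.nat_lt.decide.comp
      (Primrec.nat_mul.comp (Primrec.nat_mul.comp (Primrec.const a) hs) hd)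
      (Primrec.nat_mul.comp (Primrec.nat_add.comp (Primrec.nat_mul.comp
        ((primrec_omegaNum hG.primrec).comp Primrec.snd) hd) hs) (Primrec.const _))).to_comp
  obtain ⟨e, he⟩ := hV.exists_forcing hG (l := fun _ => 0) (Computable.const 0) hσc
  have key : ∀ s, a * 2 ^ s * 2 ^ (2 * e) < (omegaNum G s * 2 ^ (2 * e) + 2 ^ s) * 2 ^ b ↔
      Omega V - (2 : ℝ) ^ (-((e + e + 0 : ℕ) : ℤ)) < omegaApprox G s := by
    intro s
    have h2 : (2 : ℝ) ^ (-((e + e + 0 : ℕ) : ℤ)) = 1 / 2 ^ (2 * e) := by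
      rw [zpow_neg, zpow_natCast, one_div]
      congr 2
      omega
    rw [h2, hab, omegaApprox, sub_lt_iff_lt_add, div_add_div _ _ (by positivity) (by positivity),
      div_lt_div_iff₀ (by positivity) (by positivity)]
    rw [← Nat.cast_lt (α := ℝ)]
    push_cast
    constructor <;> intro h <;> nlinarith [h]
  have hpos : (0 : ℝ) < (2 : ℝ) ^ (-((e + e + 0 : ℕ) : ℤ)) := by positivity
  obtain ⟨s₀, hs₀⟩ := hG.exists_lt_omegaApprox hV.prefixFree
    (show Omega V - (2 : ℝ) ^ (-((e + e + 0 : ℕ) : ℤ)) < Omega V by linarith)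
  have hdom : (σ e 0).Dom := by
    refine Nat.rfind_dom.2 ⟨s₀, ?_, fun _ => trivial⟩
    rw [Part.mem_some_iff, eq_comm, decide_eq_true_iff]
    exact (key s₀).2 hs₀
  obtain ⟨s, hs⟩ := Part.dom_iff_mem.1 hdom
  have h1 := he e 0 s (by simp) hs
  have h2 := Nat.rfind_spec hs
  rw [Part.mem_some_iff, eq_comm, decide_eq_true_iff, key] at h2
  linarith

theorem OptimalPrefixFreeMachine.omega_mem_Ico (hV : OptimalPrefixFreeMachine V) :
    Omega V ∈ Set.Ico (0 : ℝ) 1 :=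
  ⟨omega_nonneg, hV.prefixFree.omega_le_one.lt_of_ne (by simpa using hV.omega_ne_dyadic 1 0)⟩

theorem OptimalPrefixFreeMachine.omegaApprox_mem_Ico (hV : OptimalPrefixFreeMachine V)
    (hG : StageApprox V G) (s : ℕ) : omegaApprox G s ∈ Set.Ico (0 : ℝ) 1 :=
  ⟨by unfold omegaApprox; positivity,
    (hG.omegaApprox_le hV.prefixFree s).trans_lt hV.omega_mem_Ico.2⟩

/-- The first `n` bits of the stage `s` approximation to the halting probability. -/
def omegaBits (G : ℕ → List Bool → Option (List Bool)) (s n : ℕ) : List Bool :=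
  dyadicBits (omegaNum G s) s n

theorem primrec_omegaBits (hG : Primrec₂ G) : Primrec₂ (omegaBits G) :=
  primrec_dyadicBits.comp ((((primrec_omegaNum hG).comp Primrec.fst).pair Primrec.fst).pair
    Primrec.snd)

theorem OptimalPrefixFreeMachine.omegaBits_eq (hV : OptimalPrefixFreeMachine V)
    (hG : StageApprox V G) (s n : ℕ) : omegaBits G s n = bits (omegaApprox G s) n := by
  refine (bits_dyadic ?_ n).symm
  have := (hV.omegaApprox_mem_Ico hG s).2
  rw [omegaApprox, div_lt_one (by positivity)] at this
  exact_mod_cast this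

/-- Later approximations lie between the one at stage `s` and `Ω`, so their floors are squeezed. -/
theorem OptimalPrefixFreeMachine.omegaBits_eq_bits_mono (hV : OptimalPrefixFreeMachine V)
    (hG : StageApprox V G) {s t n : ℕ} (hst : s ≤ t) (h : omegaBits G s n = bits (Omega V) n) :
    omegaBits G t n = bits (Omega V) n := by
  rw [hV.omegaBits_eq hG, bits_eq_iff (hV.omegaApprox_mem_Ico hG _) hV.omega_mem_Ico] at h ⊢
  refine le_antisymm ?_ ?_
  · gcongr
    exact hG.omegaApprox_le hV.prefixFree t
  · rw [← h]
    gcongr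
    exact hG.omegaApprox_mono hst

/-- Being no dyadic rational, `Ω` lies strictly above its truncation to `n` bits, so the
approximations eventually exceed that truncation. -/
theorem OptimalPrefixFreeMachine.exists_omegaBits_eq_bits (hV : OptimalPrefixFreeMachine V)
    (hG : StageApprox V G) (n : ℕ) : ∃ s, omegaBits G s n = bits (Omega V) n := by
  have h0 : 0 ≤ (2 : ℝ) ^ n * Omega V := mul_nonneg (by positivity) hV.omega_mem_Ico.1
  have hlt : (⌊(2 : ℝ) ^ n * Omega V⌋₊ : ℝ) / 2 ^ n < Omega V := by
    refine lt_of_le_of_ne ?_ (hV.omega_ne_dyadic _ _).symm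
    rw [div_le_iff₀ (by positivity)]
    exact (Nat.floor_le h0).trans_eq (mul_comm _ _)
  obtain ⟨s, hs⟩ := hG.exists_lt_omegaApprox hV.prefixFree hlt
  refine ⟨s, ?_⟩
  rw [hV.omegaBits_eq hG, bits_eq_iff (hV.omegaApprox_mem_Ico hG _) hV.omega_mem_Ico]
  refine le_antisymm ?_ ?_
  · gcongr
    exact hG.omegaApprox_le hV.prefixFree s
  · rw [Int.le_floor, ← Int.natCast_floor_eq_floor (a := (2 : ℝ) ^ n * Omega V)
      h0]
    rw [div_lt_iff₀ (by positivity)] at hs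
    push_cast
    linarith

end QuerySize

/-! ### Oracle computations: finite oracles, use principle, query-free programs. -/

namespace QuerySize

open Encodable

namespace OracleCode

variable {B B' : Set (List Bool)}

theorem eval_prec_zero (cf cg : OracleCode) (a : ℕ) :
    eval B (prec cf cg) (Nat.pair a 0) = eval B cf a := by
  simp [eval]

theorem eval_prec_succ (cf cg : OracleCode) (a n : ℕ) :
    eval B (prec cf cg) (Nat.pair a (n + 1)) = (eval B (prec cf cg) (Nat.pair a n)).bind fun i =>
      eval B cg (Nat.pair a (Nat.pair n i)) := by
  simp [eval]

/-- Uniformity in the finite oracle allows the reduction to be run on each stage of the enumeration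
of `Dom W`. -/
theorem partrec_eval_list (c : OracleCode) :
    Partrec₂ fun (L : List (List Bool)) (n : ℕ) => eval {s | s ∈ L} c n := by
  induction c with
  | zero => exact (Computable.const 0).partrec
  | succ => exact (Computable.succ.comp Computable.snd).partrec
  | left => exact (Computable.fst.comp (Computable.unpair.comp Computable.snd)).partrec
  | right => exact (Computable.snd.comp (Computable.unpair.comp Computable.snd)).partrec
  | query =>
    have h : Primrec fun p : List (List Bool) × ℕ =>
        p.1.all fun s => !decide (encode s = p.2) :=
      primrec_all Primrec.fst (Primrec.not.comp (Primrec.eq.decide.comp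
        (Primrec.encode.comp Primrec.snd) (Primrec.snd.comp Primrec.fst)))
    have h' : Computable fun p : List (List Bool) × ℕ => answer {s | s ∈ p.1} p.2 := by
      refine (Primrec.cond h (Primrec.const 0) (Primrec.const 1)).to_comp.of_eq fun p => ?_
      by_cases hp : ∃ s ∈ p.1, encode s = p.2
      · have : (p.1.all fun s => !decide (encode s = p.2)) = false := by
          rw [Bool.eq_false_iff]
          intro hall
          obtain ⟨s, hs, he⟩ := hp
          simpa [he] using List.all_eq_true.1 hall s hs
        rw [this]
        exact (if_pos hp).symm
      · have : (p.1.all fun s => !decide (encode s = p.2)) = true := by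
          rw [List.all_eq_true]
          intro s hs
          simpa using fun he => hp ⟨s, hs, he⟩
        rw [this]
        exact (if_neg hp).symm
    exact h'.partrec
  | pair cf cg ihf ihg =>
    exact Partrec.bind ihf (Partrec.map (ihg.comp (Computable.fst.comp Computable.fst)
      (Computable.snd.comp Computable.fst)) (Primrec₂.natPair.to_comp.comp
        (Computable.snd.comp Computable.fst) Computable.snd).to₂)
  | comp cf cg ihf ihg =>
    exact Partrec.bind ihg (ihf.comp (Computable.fst.comp Computable.fst) Computable.snd)
  | prec cf cg ihf ihg =>
    have hu : Computable fun p : List (List Bool) × ℕ => p.2.unpair :=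
      Computable.unpair.comp Computable.snd
    refine (Partrec.nat_rec (h := fun p (q : ℕ × ℕ) => eval {s | s ∈ p.1} cg
      (Nat.pair p.2.unpair.1 (Nat.pair q.1 q.2))) (Computable.snd.comp hu)
      (ihf.comp Computable.fst (Computable.fst.comp hu)) ?_).of_eq fun p => rfl
    exact ihg.comp (Computable.fst.comp Computable.fst) (Primrec₂.natPair.to_comp.comp
      (Computable.fst.comp (hu.comp Computable.fst)) (Primrec₂.natPair.to_comp.comp
        (Computable.fst.comp Computable.snd) (Computable.snd.comp Computable.snd)))
  | rfind cf ihf =>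
    refine Partrec.rfind (Partrec.map (ihf.comp (Computable.fst.comp Computable.fst)
      (Primrec₂.natPair.to_comp.comp (Computable.snd.comp Computable.fst) Computable.snd)) ?_)
    exact Primrec.eq.decide.to_comp.comp Computable.snd (Computable.const 0)

/-- A computation depends on the oracle only through the queries that it makes. -/
theorem mem_eval_of_queries {c : OracleCode} {n v : ℕ}
    (h : ∀ q, Queries B c n q → answer B q = answer B' q) (hv : v ∈ eval B c n) :
    v ∈ eval B' c n := by
  induction c generalizing n v with
  | zero => exact hv
  | succ => exact hv
  | left => exact hv
  | right => exact hv
  | query =>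
    have := h n (Queries.query n)
    simp only [eval] at hv ⊢
    rwa [← this]
  | pair cf cg ihf ihg =>
    simp only [eval, Part.mem_bind_iff, Part.mem_map_iff] at hv ⊢
    obtain ⟨a, ha, b, hb, rfl⟩ := hv
    exact ⟨a, ihf (fun q hq => h q hq.pair_left) ha, b, ihg (fun q hq => h q
      (hq.pair_right (Part.dom_iff_mem.2 ⟨a, ha⟩))) hb, rfl⟩
  | comp cf cg ihf ihg =>
    obtain ⟨a, ha, hb⟩ := Part.mem_bind_iff.1 hv
    exact Part.mem_bind_iff.2 ⟨a, ihg (fun q hq => h q hq.comp_inner) ha, ihf (fun q hq => h q (hq.comp_outer ha)) hb⟩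
  | prec cf cg ihf ihg =>
    obtain ⟨a, k, rfl⟩ : ∃ a k, n = Nat.pair a k := ⟨_, _, (Nat.pair_unpair n).symm⟩
    have key : ∀ m ≤ k, ∀ v ∈ eval B (prec cf cg) (Nat.pair a m),
        v ∈ eval B' (prec cf cg) (Nat.pair a m) := by
      intro m
      induction m with
      | zero =>
        intro _ v hv
        rw [eval_prec_zero] at hv ⊢
        exact ihf (fun q hq => h q hq.prec_base) hv
      | succ m ih =>
        intro hm v hv
        rw [eval_prec_succ, Part.mem_bind_iff] at hv ⊢
        obtain ⟨i, hi, hv⟩ := hv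
        exact ⟨i, ih (by omega) i hi, ihg (fun q hq => h q (Queries.prec_step hm hi hq)) hv⟩
    exact key k le_rfl v hv
  | rfind cf ihf =>
    replace hv := Nat.mem_rfind.1 hv
    simp only [Part.mem_map_iff] at hv
    have hlt : ∀ k < v, ∃ u ∈ eval B cf (Nat.pair n k), u ≠ 0 := fun k hk => by
      obtain ⟨u, hu, hu0⟩ := hv.2 hk
      exact ⟨u, hu, by simpa using hu0⟩
    obtain ⟨⟨u, hu, hu0⟩, h2⟩ := hv
    refine Nat.mem_rfind.2 ⟨Part.mem_map_iff _ |>.2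
      ⟨u, ihf (fun q hq => h q (hq.rfind hlt)) hu, hu0⟩, fun {m} hm => Part.mem_map_iff _ |>.2 ?_⟩
    obtain ⟨u, hu, hu0⟩ := h2 hm
    exact ⟨u, ihf (fun q hq => h q (hq.rfind fun k hk => hlt k (hk.trans hm))) hu, hu0⟩

/-- Every partial recursive function is computed by a program that makes no queries. -/
theorem exists_of_partrec {φ : ℕ →. ℕ} (h : Nat.Partrec φ) :
    ∃ c : OracleCode, (∀ B, eval B c = φ) ∧ ∀ B n q, ¬ Queries B c n q := by
  induction h with
  | zero => exact ⟨zero, fun _ => rfl, by rintro B n q ⟨⟩⟩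
  | succ => exact ⟨succ, fun _ => rfl, by rintro B n q ⟨⟩⟩
  | left => exact ⟨left, fun _ => rfl, by rintro B n q ⟨⟩⟩
  | right => exact ⟨right, fun _ => rfl, by rintro B n q ⟨⟩⟩
  | pair _ _ ihf ihg =>
    obtain ⟨cf, hf, qf⟩ := ihf
    obtain ⟨cg, hg, qg⟩ := ihg
    refine ⟨pair cf cg, fun B => ?_, ?_⟩
    · funext n
      simp [eval, hf, hg, Seq.seq, Part.map_eq_map, Part.bind_map]
    · intro B n q hq
      cases hq with
      | pair_left h => exact qf _ _ _ h
      | pair_right _ h => exact qg _ _ _ h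
  | comp _ _ ihf ihg =>
    obtain ⟨cf, hf, qf⟩ := ihf
    obtain ⟨cg, hg, qg⟩ := ihg
    refine ⟨comp cf cg, fun B => ?_, ?_⟩
    · funext n
      simp only [eval, hf, hg]
      rfl
    · intro B n q hq
      cases hq with
      | comp_inner h => exact qg _ _ _ h
      | comp_outer _ h => exact qf _ _ _ h
  | prec _ _ ihf ihg =>
    obtain ⟨cf, hf, qf⟩ := ihf
    obtain ⟨cg, hg, qg⟩ := ihg
    refine ⟨prec cf cg, fun B => ?_, ?_⟩
    · funext n
      simp [eval, hf, hg, Nat.unpaired]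
    · intro B n q hq
      cases hq with
      | prec_base h => exact qf _ _ _ h
      | prec_step _ _ h => exact qg _ _ _ h
  | rfind _ ihf =>
    obtain ⟨cf, hf, qf⟩ := ihf
    refine ⟨rfind cf, fun B => ?_, ?_⟩
    · funext n
      simp [eval, hf, Part.map_eq_map]
    · intro B n q hq
      cases hq with
      | rfind _ h => exact qf _ _ _ h

theorem exists_of_computable {φ : ℕ → ℕ} (h : Computable φ) :
    ∃ c : OracleCode, (∀ B n, eval B c n = Part.some (φ n)) ∧ ∀ B n q, ¬ Queries B c n q := by
  obtain ⟨c, hc, hq⟩ := exists_of_partrec (Partrec.nat_iff.1 h.partrec)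
  exact ⟨c, fun B n => by rw [hc]; rfl, hq⟩

end OracleCode

end QuerySize

/-! ### Counting short programs, and consistent stages of the reduction. -/

namespace QuerySize

open Encodable Filter

theorem exists_computable_choice {p : ℕ → ℕ → Bool} (hp : Computable₂ p) (h : ∀ d, ∃ n, p d n) :
    ∃ g : ℕ → ℕ, Computable g ∧ ∀ d, p d (g d) := by
  have hd : ∀ d, ∃ n, n ∈ Nat.rfind fun n => Part.some (p d n) := fun d => by
    obtain ⟨n, hn⟩ := h d
    obtain ⟨m, hm, -⟩ := Nat.rfind_min' hn
    exact ⟨m, hm⟩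
  choose g hg using hd
  refine ⟨g, Partrec.of_eq_tot (Partrec.rfind hp.partrec₂) hg, fun d => ?_⟩
  have := Nat.rfind_spec (hg d)
  rw [Part.mem_some_iff] at this
  exact this.symm

section Counting

theorem sum_two_pow_neg_le (K L c : ℕ) :
    ∑ k ∈ Finset.range K, (if L ≤ k + c then ((2 : ℝ) ^ k)⁻¹ else 0) ≤
      2 * 2 ^ c * (2 ^ L)⁻¹ := by
  set X : ℝ := 2 ^ c * (2 ^ L)⁻¹ with hX
  have hX0 : 0 < X := by positivity
  -- The induction needs the exact remainder of the geometric tail, once the tail has begun.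
  have key : ∑ k ∈ Finset.range K, (if L ≤ k + c then ((2 : ℝ) ^ k)⁻¹ else 0) = 0 ∨
      ∑ k ∈ Finset.range K, (if L ≤ k + c then ((2 : ℝ) ^ k)⁻¹ else 0) ≤
        2 * X - 2 * (2 ^ K)⁻¹ := by
    induction K with
    | zero => simp
    | succ K ih =>
      rw [Finset.sum_range_succ]
      have h2 : ((2 : ℝ) ^ K)⁻¹ = 2 * (2 ^ (K + 1))⁻¹ := by
        rw [pow_succ, mul_inv]; ring
      have hpos : (0 : ℝ) < (2 ^ (K + 1))⁻¹ := by positivity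
      split_ifs with h
      · right
        have hK : ((2 : ℝ) ^ K)⁻¹ ≤ X := by
          rw [hX, ← div_eq_mul_inv, inv_eq_one_div, div_le_div_iff₀ (by positivity) (by positivity),
            one_mul, ← pow_add]
          exact pow_le_pow_right₀ one_le_two (by omega)
        rcases ih with h | h <;> linarith
      · rcases ih with h | h
        · left; linarith
        · right; linarith
  have : (0 : ℝ) < (2 ^ K)⁻¹ := by positivity
  rcases key with h | h <;> rw [mul_assoc, ← hX] <;> linarith

/-- After exchanging the sums, each `p` contributes a geometric tail of at most `2 * 2 ^ c` times
its weight, and the weights sum to at most 1. -/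
theorem PrefixFree.sum_count_le {P : Finset (List Bool)}
    (hP : PrefixFree (P : Set (List Bool))) (K c : ℕ) :
    ∑ k ∈ Finset.range K, ((P.filter fun p => p.length ≤ k + c).card : ℝ) * (2 ^ k)⁻¹ ≤
      2 * 2 ^ c := by
  have h : ∀ k : ℕ, ((P.filter fun p => p.length ≤ k + c).card : ℝ) * (2 ^ k)⁻¹ =
      ∑ p ∈ P, if p.length ≤ k + c then ((2 : ℝ) ^ k)⁻¹ else 0 := by
    intro k
    rw [← Finset.sum_filter, Finset.sum_const, nsmul_eq_mul]
  simp_rw [h]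
  rw [Finset.sum_comm]
  refine (Finset.sum_le_sum fun p _ => sum_two_pow_neg_le K p.length c).trans ?_
  rw [← Finset.mul_sum]
  have := hP.sum_weight_le_one
  simp only [weight, zpow_neg, zpow_natCast] at this
  exact mul_le_of_le_one_right (by positivity) this

/-- Indices with the same value `k` of `f` are grouped. Within a group the powers `2 ^ n` sum to
less than twice the largest, which is at most `C * D k`. -/
theorem sum_fiber_le {f D : ℕ → ℕ} {N C : ℕ} (h : ∀ n ≤ N, 2 ^ n ≤ C * D (f n)) {K : ℕ}
    (hK : ∀ n ≤ N, f n < K) :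
    ∑ n ∈ Finset.range (N + 1), (2 : ℝ) ^ n * (2 ^ f n)⁻¹ ≤
      2 * C * ∑ k ∈ Finset.range K, (D k : ℝ) * (2 ^ k)⁻¹ := by
  have hmaps : ∀ n ∈ Finset.range (N + 1), f n ∈ Finset.range K := fun n hn =>
    Finset.mem_range.2 (hK n (Nat.lt_succ_iff.1 (Finset.mem_range.1 hn)))
  rw [← Finset.sum_fiberwise_of_maps_to hmaps, Finset.mul_sum]
  refine Finset.sum_le_sum fun k _ => ?_
  set S := (Finset.range (N + 1)).filter fun n => f n = k with hS
  have h1 : ∑ n ∈ S, (2 : ℝ) ^ n * (2 ^ f n)⁻¹ = ((∑ n ∈ S, 2 ^ n : ℕ) : ℝ) * (2 ^ k)⁻¹ := by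
    push_cast
    rw [Finset.sum_mul]
    refine Finset.sum_congr rfl fun n hn => ?_
    rw [(Finset.mem_filter.1 hn).2]
  have h2 : ∑ n ∈ S, 2 ^ n ≤ 2 * C * D k := by
    rcases S.eq_empty_or_nonempty with hE | hE
    · simp [hE]
    · have hm := Finset.mem_filter.1 (S.max'_mem hE)
      have h3 := h _ (Nat.lt_succ_iff.1 (Finset.mem_range.1 hm.1))
      rw [hm.2] at h3
      have h4 := Nat.geomSum_lt (le_refl 2) (n := S.max' hE + 1)
        fun n hn => Nat.lt_succ_iff.2 (S.le_max' n hn)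
      rw [pow_succ] at h4
      linarith
  rw [h1, ← mul_assoc]
  gcongr
  exact_mod_cast h2

end Counting

section Stages

variable {W : List Bool →. List Bool} {G : ℕ → List Bool → Option (List Bool)}

theorem StageApprox.progs_sublist (hG : StageApprox W G) {s t : ℕ} (hst : s ≤ t) (k : ℕ) :
    (progs G s k).Sublist (progs G t k) :=
  List.monotone_filter_right _ fun _ => hG.isSome_mono hst

theorem StageApprox.eventually_progs_eq (hG : StageApprox W G) (k : ℕ) :
    ∃ L : List (List Bool), (∀ p, p ∈ L ↔ p.length ≤ k ∧ p ∈ W.Dom) ∧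
      ∀ᶠ s in atTop, progs G s k = L := by
  classical
  refine ⟨(stringsUpTo k).filter fun p => p ∈ W.Dom, fun p => by simp [mem_stringsUpTo], ?_⟩
  have h : ∀ p ∈ (stringsUpTo k).toFinset, ∀ᶠ s in atTop, ((G s p).isSome ↔ p ∈ W.Dom) := by
    intro p _
    by_cases hp : p ∈ W.Dom
    · obtain ⟨s, hs⟩ := hG.dom_iff.1 hp
      filter_upwards [eventually_ge_atTop s] with t ht
      exact iff_of_true (hG.isSome_mono ht hs) hp
    · exact Eventually.of_forall fun s => iff_of_false (fun h => hp (hG.dom_iff.2 ⟨s, h⟩)) hp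
  filter_upwards [(eventually_all_finset _).2 h] with s hs
  refine List.filter_congr fun p hp => ?_
  rw [Bool.eq_iff_iff, hs p (List.mem_toFinset.2 hp), decide_eq_true_iff]

end Stages

section Consistency

variable {V W : List Bool →. List Bool} {GV GW : ℕ → List Bool → Option (List Bool)}
  {GM : ℕ → List (List Bool) × ℕ → Option ℕ} {f : ℕ → ℕ} {c : ℕ} {M : OracleCode}

/-- At stage `s` the reduction enumerated by `GM`, with the queries bounded by the table `T`,
decides correctly which strings of length less than `T.length` are prefixes of `Ω`. -/
def consistent (GV GW : ℕ → List Bool → Option (List Bool))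
    (GM : ℕ → List (List Bool) × ℕ → Option ℕ) (T : List ℕ) (s : ℕ) : Bool :=
  (stringsUpTo (T.length - 1)).all fun x =>
    decide (GM s (progs GW s (T.getD x.length 0), encode x) =
      some (cond (decide (x = omegaBits GV s x.length)) 1 0))

/-- The query bound enters as a finite table because `f` itself is only computable. -/
theorem primrec_consistent (hV : Primrec₂ GV) (hW : Primrec₂ GW) (hM : Primrec₂ GM) :
    Primrec₂ (consistent GV GW GM) := by
  refine primrec_all (primrec_stringsUpTo.comp
    (Primrec.nat_sub.comp (Primrec.list_length.comp Primrec.fst) (Primrec.const 1))) ?_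
  have hT : Primrec fun q : (List ℕ × ℕ) × List Bool => q.1.1 := Primrec.fst.comp Primrec.fst
  have hs : Primrec fun q : (List ℕ × ℕ) × List Bool => q.1.2 := Primrec.snd.comp Primrec.fst
  have hx : Primrec fun q : (List ℕ × ℕ) × List Bool => q.2 := Primrec.snd
  have hl := Primrec.list_length.comp hx
  exact Primrec.eq.decide.comp
    (hM.comp hs (((primrec_progs hW).comp hs ((Primrec.list_getD 0).comp hT hl)).pair
      (Primrec.encode.comp hx)))
    (Primrec.option_some.comp (Primrec.cond
      (Primrec.eq.decide.comp hx ((primrec_omegaBits hV).comp hs hl))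
      (Primrec.const 1) (Primrec.const 0)))

theorem consistent_iff {N s : ℕ} :
    consistent GV GW GM ((List.range (N + 1)).map f) s = true ↔ ∀ x : List Bool, x.length ≤ N →
      GM s (progs GW s (f x.length), encode x) =
        some (cond (decide (x = omegaBits GV s x.length)) 1 0) := by
  unfold consistent
  simp only [List.length_map, List.length_range, Nat.add_sub_cancel, List.all_eq_true,
    mem_stringsUpTo, decide_eq_true_iff]
  refine forall_congr' fun x => imp_congr_right fun hx => ?_
  rw [List.getD_eq_getElem _ _ (by simpa using Nat.lt_succ_iff.2 hx)]
  simp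

/-- On the prefix taken from stage `s`, both stages run `M` with the same finite oracle, hence with
the same answer. Stage `s` requires the answer 1, and so stage `t` must have the same prefix. -/
theorem omegaBits_eq_of_progs_eq (hGM : StageApprox
    (fun p : List (List Bool) × ℕ => M.eval {s | s ∈ p.1} p.2) GM) {N s t n : ℕ}
    (hs : consistent GV GW GM ((List.range (N + 1)).map f) s = true)
    (ht : consistent GV GW GM ((List.range (N + 1)).map f) t = true) (hn : n ≤ N)
    (h : progs GW s (f n) = progs GW t (f n)) : omegaBits GV s n = omegaBits GV t n := by
  have hlen : ∀ u, (omegaBits GV u n).length = n := fun u => by simp [omegaBits, dyadicBits]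
  have h1 := consistent_iff.1 hs (omegaBits GV s n) (by rw [hlen]; exact hn)
  have h2 := consistent_iff.1 ht (omegaBits GV s n) (by rw [hlen]; exact hn)
  rw [hlen] at h1 h2
  rw [h] at h1
  have := Part.mem_unique (hGM.mem_iff.2 ⟨s, h1⟩) (hGM.mem_iff.2 ⟨t, h2⟩)
  by_contra hne
  simp [hne] at this

/-- Only finitely many `x` matter. For each, the truncated oracle and the bits of `Ω` stabilize, and
`M` cannot tell the truncated oracle from `Dom W` because its queries are short. -/
theorem eventually_consistent (hV : OptimalPrefixFreeMachine V) (hGV : StageApprox V GV)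
    (hGW : StageApprox W GW)
    (hGM : StageApprox (fun p : List (List Bool) × ℕ => M.eval {s | s ∈ p.1} p.2) GM)
    (hM : TuringReducibleVia M (Pf (Omega V)) W.Dom)
    (hq : ∀ x : List Bool, ∀ q : ℕ, M.Queries W.Dom (encode x) q →
      ∃ s : List Bool, encode s = q ∧ s.length ≤ f x.length) (N : ℕ) :
    ∀ᶠ s in atTop, consistent GV GW GM ((List.range (N + 1)).map f) s = true := by
  simp only [consistent_iff]
  have h : ∀ x ∈ (stringsUpTo N).toFinset, ∀ᶠ s in atTop,
      GM s (progs GW s (f x.length), encode x) =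
        some (cond (decide (x = omegaBits GV s x.length)) 1 0) := by
    intro x _
    obtain ⟨L, hL, hLs⟩ := hGW.eventually_progs_eq (f x.length)
    obtain ⟨s₀, hs₀⟩ := hV.exists_omegaBits_eq_bits hGV x.length
    have hmem : cond (decide (x = bits (Omega V) x.length)) 1 0 ∈
        M.eval {s | s ∈ L} (encode x) := by
      refine OracleCode.mem_eval_of_queries (B := W.Dom) (fun q hqq => ?_) ?_
      · obtain ⟨u, rfl, hu⟩ := hq x q hqq
        unfold OracleCode.answer
        congr 1
        refine propext (exists_congr fun v => and_congr_left fun hv => ?_)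
        rw [encode_inj] at hv
        subst hv
        exact ⟨fun h => (hL v).2 ⟨hu, h⟩, fun h => ((hL v).1 h).2⟩
      · by_cases hx : x = bits (Omega V) x.length
        · rw [decide_eq_true hx]
          exact (hM x).1 (mem_Pf_iff.2 hx)
        · rw [decide_eq_false hx]
          exact (hM x).2 (mt mem_Pf_iff.1 hx)
    obtain ⟨s₁, hs₁⟩ := hGM.mem_iff (a := (L, encode x)).1 hmem
    filter_upwards [hLs, eventually_ge_atTop s₀, eventually_ge_atTop s₁] with s h1 h2 h3
    rw [h1, hV.omegaBits_eq_bits_mono hGV h2 hs₀]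
    exact hGM.mono h3 hs₁
  filter_upwards [(eventually_all_finset _).2 h] with s hs x hx
  exact hs x (List.mem_toFinset.2 (mem_stringsUpTo.2 hx))

end Consistency

end QuerySize

/-! ### Reducibility implies convergence. -/

namespace QuerySize

open Encodable Filter

variable {V W : List Bool →. List Bool} {GV GW : ℕ → List Bool → Option (List Bool)}
  {GM : ℕ → List (List Bool) × ℕ → Option ℕ} {f : ℕ → ℕ} {M : OracleCode}

/-- If the approximation to `Ω` grows `2 ^ (N - a)` times by `2 ^ (-N)` through consistent stages,
then the oracle receives many strings of length at most `f n`, for every `n ≤ N`. -/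
theorem two_pow_le_length_progs (hV : OptimalPrefixFreeMachine V) (hGV : StageApprox V GV)
    (hGW : StageApprox W GW)
    (hGM : StageApprox (fun p : List (List Bool) × ℕ => M.eval {s | s ∈ p.1} p.2) GM)
    {N a : ℕ} {st : ℕ → ℕ}
    (hcons : ∀ i < 2 ^ (N - a),
      consistent GV GW GM ((List.range (N + 1)).map f) (st (i + 1)) = true)
    (hinc : ∀ i < 2 ^ (N - a),
      omegaApprox GV (st i) + ((2 : ℝ) ^ N)⁻¹ ≤ omegaApprox GV (st (i + 1)))
    {n : ℕ} (hn : n ≤ N) :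
    2 ^ n ≤ 2 ^ a * ((progs GW (st (2 ^ (N - a))) (f n)).length + 1) := by
  have hadd : ∀ k i, i + k ≤ 2 ^ (N - a) →
      omegaApprox GV (st i) + k * ((2 : ℝ) ^ N)⁻¹ ≤ omegaApprox GV (st (i + k)) := by
    intro k i
    induction k with
    | zero => simp
    | succ k ih =>
      intro h
      have h1 := ih (by omega)
      have h2 := hinc (i + k) (by omega)
      rw [← add_assoc]
      push_cast
      linarith
  have hN : (0 : ℝ) < ((2 : ℝ) ^ N)⁻¹ := by positivity
  have hmono : ∀ i j, i ≤ j → j ≤ 2 ^ (N - a) → st i ≤ st j := by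
    intro i j hij hj
    rcases hij.eq_or_lt with rfl | hlt
    · exact le_rfl
    by_contra! hlt'
    have h1 := hadd (j - i) i (by omega)
    rw [Nat.add_sub_cancel' hij] at h1
    have h2 := hGV.omegaApprox_mono hlt'.le
    have h3 : (0 : ℝ) < ((j - i : ℕ) : ℝ) * ((2 : ℝ) ^ N)⁻¹ :=
      mul_pos (by exact_mod_cast (by omega : 0 < j - i)) hN
    linarith
  rcases lt_or_ge n a with hna | hna
  · exact (Nat.pow_le_pow_right two_pos hna.le).trans (Nat.le_mul_of_pos_right _ (by omega))
  have hm : 2 ^ (n - a) * 2 ^ (N - n) = 2 ^ (N - a) := by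
    rw [← pow_add]
    congr 1
    omega
  have hle : ∀ j ≤ 2 ^ (n - a), j * 2 ^ (N - n) ≤ 2 ^ (N - a) := fun j hj => by
    rw [← hm]
    gcongr
  have hp : 0 < 2 ^ (N - n) := by positivity
  have hc : ∀ j, 1 ≤ j → j ≤ 2 ^ (n - a) →
      consistent GV GW GM ((List.range (N + 1)).map f) (st (j * 2 ^ (N - n))) = true := by
    intro j h1 hj
    have := hle j hj
    have h0 : 0 < j * 2 ^ (N - n) := Nat.mul_pos h1 hp
    have := hcons (j * 2 ^ (N - n) - 1) (by omega)
    rwa [Nat.sub_add_cancel h0] at this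
  -- Every `2 ^ (N - n)`-th stage is sampled, so that consecutive samples differ by at least
  -- `2^(-n)`. Counting starts at `j = 1` because stage `st 0` need not be consistent; this costs
  -- the `+ 1`.
  have hcount : ∀ j, 1 ≤ j → j ≤ 2 ^ (n - a) →
      j ≤ (progs GW (st (j * 2 ^ (N - n))) (f n)).length + 1 := by
    intro j hj
    induction j, hj using Nat.le_induction with
    | base => intro _; omega
    | succ j hj ih =>
      intro hj'
      have hi := ih (by omega)
      have hst := hmono (j * 2 ^ (N - n)) ((j + 1) * 2 ^ (N - n)) (by gcongr; omega) (hle _ hj')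
      have hsub := hGW.progs_sublist hst (f n)
      have hne : progs GW (st (j * 2 ^ (N - n))) (f n) ≠
          progs GW (st ((j + 1) * 2 ^ (N - n))) (f n) := by
        intro heq
        have hb := omegaBits_eq_of_progs_eq hGM (hc j hj (by omega)) (hc (j + 1) (by omega) hj')
          hn heq
        rw [hV.omegaBits_eq hGV, hV.omegaBits_eq hGV, bits_eq_iff (hV.omegaApprox_mem_Ico hGV _)
          (hV.omegaApprox_mem_Ico hGV _)] at hb
        have h1 := hadd (2 ^ (N - n)) (j * 2 ^ (N - n)) (by
          have := hle _ hj'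
          rwa [add_mul, one_mul] at this)
        have h2 : ((2 ^ (N - n) : ℕ) : ℝ) * ((2 : ℝ) ^ N)⁻¹ = (2 ^ n)⁻¹ := by
          push_cast
          rw [mul_inv_eq_iff_eq_mul₀ (by positivity), eq_comm, inv_mul_eq_iff_eq_mul₀
            (by positivity), ← pow_add]
          congr 1
          omega
        rw [h2] at h1
        -- A growth of `2^(-n)` raises the floor of `2 ^ n * Ω_s`, so the first `n` bits cannot
        -- agree.
        have h3 : (2 : ℝ) ^ n * omegaApprox GV (st (j * 2 ^ (N - n))) + 1 ≤
            2 ^ n * omegaApprox GV (st ((j + 1) * 2 ^ (N - n))) := by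
          rw [add_mul j 1, one_mul]
          calc _ = (2 : ℝ) ^ n * (omegaApprox GV (st (j * 2 ^ (N - n))) + (2 ^ n)⁻¹) := by
                rw [mul_add, mul_inv_cancel₀ (by positivity)]
            _ ≤ _ := by gcongr
        have h4 := Int.floor_mono h3
        rw [Int.floor_add_one] at h4
        omega
      have hlen := hsub.length_le
      rcases hlen.eq_or_lt with he | hlt
      · exact absurd (hsub.eq_of_length he) hne
      · omega
  have h1 := hcount _ (Nat.one_le_two_pow) le_rfl
  rw [hm] at h1
  calc 2 ^ n = 2 ^ a * 2 ^ (n - a) := by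
        rw [← pow_add]
        congr 1
        omega
    _ ≤ _ := by gcongr

/-- Grouping by the value of `f` costs a factor `2 * 2 ^ a`. The weighted program counts and the
added ones contribute at most 2 each. -/
theorem sum_le_of_two_pow_le_length_progs (hW : PrefixFree W.Dom) (hGW : StageApprox W GW)
    (hf : Monotone f) {N a u : ℕ}
    (h : ∀ n ≤ N, 2 ^ n ≤ 2 ^ a * ((progs GW u (f n)).length + 1)) :
    ∑ n ∈ Finset.range (N + 1), (2 : ℝ) ^ n * (2 ^ f n)⁻¹ ≤ 8 * 2 ^ a := by
  set P := (progs GW u (f N)).toFinset with hP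
  have hPf : PrefixFree (P : Set (List Bool)) := hW.mono (hGW.progs_subset _ _)
  have hD : ∀ n ≤ N, (progs GW u (f n)).length = (P.filter fun p => p.length ≤ f n + 0).card := by
    intro n hn
    rw [← List.toFinset_card_of_nodup (nodup_progs _ _ _)]
    congr 1
    ext p
    have := hf hn
    simp only [hP, List.mem_toFinset, mem_progs, Finset.mem_filter]
    constructor
    · rintro ⟨h1, h2⟩
      exact ⟨⟨by omega, h2⟩, h1⟩
    · rintro ⟨⟨-, h2⟩, h1⟩
      exact ⟨h1, h2⟩
  have h1 := sum_fiber_le (f := f) (D := fun k => (P.filter fun p => p.length ≤ k + 0).card + 1)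
    (N := N) (C := 2 ^ a) (fun n hn => by rw [← hD n hn]; exact h n hn) (K := f N + 1)
    (fun n hn => Nat.lt_succ_iff.2 (hf hn))
  have h2 := hPf.sum_count_le (f N + 1) 0
  have h3 : ∑ k ∈ Finset.range (f N + 1), ((2 : ℝ) ^ k)⁻¹ ≤ 2 := by
    simpa using sum_two_pow_neg_le (f N + 1) 0 0
  have h4 : ∑ k ∈ Finset.range (f N + 1),
      (((P.filter fun p => p.length ≤ k + 0).card + 1 : ℕ) : ℝ) * (2 ^ k)⁻¹ ≤ 4 := by
    push_cast
    simp only [add_mul, one_mul, Finset.sum_add_distrib]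
    norm_num at h2 ⊢
    linarith
  refine h1.trans ?_
  push_cast at h4 ⊢
  calc _ ≤ 2 * 2 ^ a * (4 : ℝ) := by gcongr
    _ = _ := by ring

theorem summable_of_reducible (hV : OptimalPrefixFreeMachine V) (hW : PrefixFreeMachine W)
    (hf : Monotone f) (hfc : Computable f)
    (h : ReducibleInQuerySize f (Pf (Omega V)) W.Dom) :
    Summable fun n : ℕ => (2 : ℝ) ^ n * (2 ^ f n)⁻¹ := by
  obtain ⟨M, hM, hq⟩ := h
  obtain ⟨GV, hGV⟩ := exists_stageApprox hV.partrec
  obtain ⟨GW, hGW⟩ := exists_stageApprox hW.partrec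
  obtain ⟨GM, hGM⟩ := exists_stageApprox
    (F := fun p : List (List Bool) × ℕ => M.eval {s | s ∈ p.1} p.2) M.partrec_eval_list
  by_contra hns
  rw [not_summable_iff_tendsto_nat_atTop_of_nonneg (fun n => by positivity)] at hns
  -- Clearing the denominator `2 ^ f N` makes the size of a partial sum decidable; monotonicity of
  -- `f` keeps the exponents free of truncation.
  have hsum : ∀ N, ((∑ i ∈ Finset.range (N + 1), 2 ^ (i + (f N - f i)) : ℕ) : ℝ) =
      2 ^ f N * ∑ n ∈ Finset.range (N + 1), (2 : ℝ) ^ n * (2 ^ f n)⁻¹ := by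
    intro N
    push_cast
    rw [Finset.mul_sum]
    refine Finset.sum_congr rfl fun n hn => ?_
    have := hf (Nat.lt_succ_iff.1 (Finset.mem_range.1 hn))
    rw [pow_add, pow_sub₀ _ two_ne_zero this]
    ring
  -- the level of the `d`-th strategy
  obtain ⟨N, hNc, hN⟩ : ∃ N : ℕ → ℕ, Computable N ∧ ∀ d, 2 * d ≤ N d ∧
      8 * 2 ^ (2 * d) * 2 ^ f (N d) <
        ∑ i ∈ Finset.range (N d + 1), 2 ^ (i + (f (N d) - f i)) := by
    have hsumc : Computable fun N : ℕ =>
        ∑ i ∈ Finset.range (N + 1), 2 ^ (i + (f N - f i)) := by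
      refine (computable_sum (f := fun N i => 2 ^ (i + (f N - f i))) ?_).comp Computable.id
        Computable.succ
      exact primrec_nat_pow.to_comp.comp (Computable.const 2) (Primrec.nat_add.to_comp.comp
        Computable.snd (Primrec.nat_sub.to_comp.comp (hfc.comp Computable.fst)
          (hfc.comp Computable.snd)))
    have hpc : Computable₂ fun d N : ℕ => decide (2 * d ≤ N) &&
        decide (8 * 2 ^ (2 * d) * 2 ^ f N <
          ∑ i ∈ Finset.range (N + 1), 2 ^ (i + (f N - f i))) := by
      have h2d : Computable fun p : ℕ × ℕ => 2 * p.1 :=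
        Primrec.nat_mul.to_comp.comp (Computable.const 2) Computable.fst
      refine Primrec.and.to_comp.comp (Primrec.nat_le.decide.to_comp.comp h2d Computable.snd)
        (Primrec.nat_lt.decide.to_comp.comp ?_ (hsumc.comp Computable.snd))
      exact Primrec.nat_mul.to_comp.comp (Primrec.nat_mul.to_comp.comp (Computable.const 8)
        (primrec_nat_pow.to_comp.comp (Computable.const 2) h2d))
        (primrec_nat_pow.to_comp.comp (Computable.const 2) (hfc.comp Computable.snd))
    obtain ⟨N, hNc, hN⟩ := exists_computable_choice hpc fun d => by
      obtain ⟨N, h1, h2⟩ := (((tendsto_add_atTop_iff_nat 1).2 hns).eventually_gt_atTop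
        (8 * 2 ^ (2 * d)) |>.and (eventually_ge_atTop (2 * d))).exists
      refine ⟨N, ?_⟩
      simp only [Bool.and_eq_true, decide_eq_true_iff]
      refine ⟨h2, ?_⟩
      rw [← Nat.cast_lt (α := ℝ), hsum]
      push_cast
      rw [mul_comm]
      gcongr
    exact ⟨N, hNc, fun d => by simpa using hN d⟩
  -- the next stage at which a request is placed
  set next : ℕ → ℕ → ℕ →. Bool := fun d r s => Part.some
    (consistent GV GW GM ((List.range (N d + 1)).map f) s &&
      decide ((omegaNum GV r * 2 ^ N d + 2 ^ r) * 2 ^ s ≤ omegaNum GV s * (2 ^ r * 2 ^ N d)))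
    with hnext
  have hnext_iff : ∀ d r s, true ∈ next d r s ↔
      consistent GV GW GM ((List.range (N d + 1)).map f) s = true ∧
        omegaApprox GV r + ((2 : ℝ) ^ N d)⁻¹ ≤ omegaApprox GV s := by
    intro d r s
    rw [hnext, Part.mem_some_iff, eq_comm, Bool.and_eq_true, decide_eq_true_iff]
    refine and_congr_right fun _ => ?_
    rw [omegaApprox, omegaApprox, inv_eq_one_div, div_add_div _ _ (by positivity) (by positivity),
      div_le_div_iff₀ (by positivity) (by positivity), ← Nat.cast_le (α := ℝ)]
    push_cast
    rw [mul_one]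
  -- After each request the strategy waits for a consistent stage at which `Ω_s` has grown by `2^(-N
  -- d)`, and places the next request there.
  set σ : ℕ → ℕ →. ℕ := fun d i =>
    Nat.rec (Part.some 0) (fun _ r => r.bind fun r => Nat.rfind (next d r)) i with hσ
  have hσc : Partrec₂ σ := by
    refine Partrec.nat_rec (f := fun p : ℕ × ℕ => p.2) (g := fun _ => Part.some 0)
      (h := fun p q => Nat.rfind (next p.1 q.2)) Computable.snd (Computable.const 0).partrec ?_
    have hcomp : Computable fun z : ((ℕ × ℕ) × (ℕ × ℕ)) × ℕ =>
        (consistent GV GW GM ((List.range (N z.1.1.1 + 1)).map f) z.2 &&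
          decide ((omegaNum GV z.1.2.2 * 2 ^ N z.1.1.1 + 2 ^ z.1.2.2) * 2 ^ z.2 ≤
            omegaNum GV z.2 * (2 ^ z.1.2.2 * 2 ^ N z.1.1.1))) := by
      have hs : Computable fun z : ((ℕ × ℕ) × (ℕ × ℕ)) × ℕ => z.2 := Computable.snd
      have hr : Computable fun z : ((ℕ × ℕ) × (ℕ × ℕ)) × ℕ => z.1.2.2 :=
        Computable.snd.comp (Computable.snd.comp Computable.fst)
      have hd : Computable fun z : ((ℕ × ℕ) × (ℕ × ℕ)) × ℕ => N z.1.1.1 :=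
        hNc.comp (Computable.fst.comp (Computable.fst.comp Computable.fst))
      have hpow : ∀ {g : ((ℕ × ℕ) × (ℕ × ℕ)) × ℕ → ℕ}, Computable g →
          Computable fun z => 2 ^ g z := fun hg =>
        primrec_nat_pow.to_comp.comp (Computable.const 2) hg
      have hnum := (primrec_omegaNum hGV.primrec).to_comp
      have hmul := Primrec.nat_mul.to_comp
      refine Primrec.and.to_comp.comp
        ((primrec_consistent hGV.primrec hGW.primrec hGM.primrec).to_comp.comp
          ((computable_map_range hfc).comp (Computable.succ.comp hd)) hs)
        (Primrec.nat_le.decide.to_comp.comp ?_ ?_)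
      · exact hmul.comp (Primrec.nat_add.to_comp.comp (hmul.comp (hnum.comp hr) (hpow hd))
          (hpow hr)) (hpow hs)
      · exact hmul.comp (hnum.comp hs) (hmul.comp (hpow hr) (hpow hd))
    exact Partrec.rfind hcomp.partrec
  have hlc : Computable fun d => N d - 2 * d :=
    Primrec.nat_sub.to_comp.comp hNc (Primrec.nat_mul.to_comp.comp (Computable.const 2)
      Computable.id)
  obtain ⟨e, he⟩ := hV.exists_forcing hGV hlc hσc
  -- The overhead `e` is known only after the machine is built, so all strategies `d` run in
  -- parallel. A request of strategy `d` forces growth by `2^(-(N d + e - d))`, which for `d = e +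
  -- 1` is twice the awaited `2^(-N d)`.
  set d := e + 1 with hd
  obtain ⟨hN1, hN2⟩ := hN d
  have hgap : (2 : ℝ) ^ (-((e + d + (N d - 2 * d) : ℕ) : ℤ)) = 2 * ((2 : ℝ) ^ N d)⁻¹ := by
    have : N d = e + d + (N d - 2 * d) + 1 := by omega
    conv_rhs => rw [this]
    rw [zpow_neg, zpow_natCast, pow_succ, mul_inv]
    ring
  have hpos : (0 : ℝ) < ((2 : ℝ) ^ N d)⁻¹ := by positivity
  have hstep : ∀ i s, i < 2 ^ (N d - 2 * d) → s ∈ σ d i → ∃ t, t ∈ Nat.rfind (next d s) := by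
    intro i s hi hs
    have h1 := he d i s hi hs
    rw [hgap] at h1
    obtain ⟨t₁, ht₁⟩ := hGV.exists_lt_omegaApprox hV.prefixFree
      (show omegaApprox GV s + ((2 : ℝ) ^ N d)⁻¹ < Omega V by linarith)
    obtain ⟨t, ht, ht'⟩ := ((eventually_consistent hV hGV hGW hGM hM hq (N d)).and
      (eventually_ge_atTop t₁)).exists
    have hn := (hnext_iff d s t).2 ⟨ht, ht₁.le.trans (hGV.omegaApprox_mono ht')⟩
    exact Part.dom_iff_mem.1 (Nat.rfind_dom.2 ⟨t, hn, fun _ => trivial⟩)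
  have hex : ∀ i, ∃ s, i ≤ 2 ^ (N d - 2 * d) → s ∈ σ d i := by
    intro i
    induction i with
    | zero => exact ⟨0, fun _ => Part.mem_some _⟩
    | succ i ih =>
      obtain ⟨s, hs⟩ := ih
      by_cases hi : i + 1 ≤ 2 ^ (N d - 2 * d)
      · obtain ⟨t, ht⟩ := hstep i s hi (hs (by omega))
        exact ⟨t, fun _ => Part.mem_bind (hs (by omega)) ht⟩
      · exact ⟨0, fun h => absurd h hi⟩
  choose st hst using hex
  have hspec : ∀ i < 2 ^ (N d - 2 * d), true ∈ next d (st i) (st (i + 1)) := by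
    intro i hi
    obtain ⟨r, hr, ht⟩ := Part.mem_bind_iff.1 (hst (i + 1) hi)
    rw [Part.mem_unique hr (hst i hi.le)] at ht
    exact Nat.rfind_spec ht
  have hle := sum_le_of_two_pow_le_length_progs hW.prefixFree hGW hf fun n hn =>
    two_pow_le_length_progs (f := f) hV hGV hGW hGM
      (fun i hi => ((hnext_iff d _ _).1 (hspec i hi)).1)
      (fun i hi => ((hnext_iff d _ _).1 (hspec i hi)).2) hn
  rw [← Nat.cast_lt (α := ℝ), hsum] at hN2
  push_cast at hN2
  have : 8 * 2 ^ (2 * d) * (2 : ℝ) ^ f (N d) < 8 * 2 ^ (2 * d) * (2 : ℝ) ^ f (N d) :=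
    calc _ < _ := hN2
      _ ≤ 2 ^ f (N d) * (8 * 2 ^ (2 * d)) := by gcongr
      _ = _ := mul_comm _ _
  exact lt_irrefl _ this

end QuerySize

/-! ### Convergence implies reducibility. -/

namespace QuerySize

open Encodable Filter

/-- An effective form of Kraft's inequality, by the Shannon-Fano-Elias construction. -/
theorem exists_prefix_code {l : ℕ → ℕ} (hl : Computable l)
    (h : ∀ n, ∑ k ∈ Finset.range n, ((2 : ℝ) ^ l k)⁻¹ ≤ 1) :
    ∃ u : ℕ → List Bool, Computable u ∧ (∀ m n, u m <+: u n → m = n) ∧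
      ∀ n, (u n).length = l n + 1 := by
  set S : ℕ → ℝ := fun n => ∑ k ∈ Finset.range n, ((2 : ℝ) ^ l k)⁻¹ with hS
  -- `mid n` is the midpoint of the `n`-th of consecutive intervals of length `2^(-l n)`; its first
  -- `l n + 1` bits form the codeword.
  set mid : ℕ → ℝ := fun n => S n + ((2 : ℝ) ^ (l n + 1))⁻¹ with hmid
  have hsucc : ∀ n, S (n + 1) = mid n + ((2 : ℝ) ^ (l n + 1))⁻¹ := by
    intro n
    simp only [hS, hmid, Finset.sum_range_succ, pow_succ, mul_inv]
    ring
  have hpos : ∀ k : ℕ, (0 : ℝ) < ((2 : ℝ) ^ k)⁻¹ := fun k => by positivity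
  have hSmono : Monotone S := monotone_nat_of_le_succ fun n => by
    simp only [hS, Finset.sum_range_succ]
    linarith [hpos (l n)]
  have hmem : ∀ n, mid n ∈ Set.Ico (0 : ℝ) 1 := by
    intro n
    refine ⟨by simp only [hmid, hS]; positivity, ?_⟩
    have h1 : S (n + 1) ≤ 1 := h (n + 1)
    rw [hsucc] at h1
    linarith [hpos (l n + 1)]
  have hsep : ∀ m n, m < n →
      mid m + ((2 : ℝ) ^ (l m + 1))⁻¹ + ((2 : ℝ) ^ (l n + 1))⁻¹ ≤ mid n := by
    intro m n hmn
    rw [← hsucc]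
    have := hSmono (Nat.succ_le_of_lt hmn)
    simp only [hmid]
    linarith
  -- `2 ^ E n` is a common denominator of the terms of `S n`, and `A n` is the numerator.
  set E : ℕ → ℕ := fun n => ∑ k ∈ Finset.range n, l k with hE
  set A : ℕ → ℕ := fun n => ∑ k ∈ Finset.range n, 2 ^ (E n - l k) with hA
  have hEc : Computable E :=
    (computable_sum (f := fun _ k => l k) (hl.comp Computable.snd)).comp Computable.id Computable.id
  have hpow : ∀ {g : ℕ → ℕ}, Computable g → Computable fun z => 2 ^ g z := fun hg =>
    primrec_nat_pow.to_comp.comp (Computable.const 2) hg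
  have hAc : Computable A := by
    refine (computable_sum (f := fun n k => 2 ^ (E n - l k)) ?_).comp Computable.id Computable.id
    exact primrec_nat_pow.to_comp.comp (Computable.const 2) (Primrec.nat_sub.to_comp.comp
      (hEc.comp Computable.fst) (hl.comp Computable.snd))
  have hmidA : ∀ n, mid n =
      ((2 * A n * 2 ^ l n + 2 ^ E n : ℕ) : ℝ) / 2 ^ (E n + l n + 1) := by
    intro n
    have hSA : S n = (A n : ℝ) * (2 ^ E n)⁻¹ := by
      simp only [hS, hA]
      push_cast
      rw [Finset.sum_mul]
      refine Finset.sum_congr rfl fun k hk => ?_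
      have : l k ≤ E n := Finset.single_le_sum (f := l) (fun _ _ => Nat.zero_le _) hk
      rw [pow_sub₀ _ two_ne_zero this]
      field_simp
    simp only [hmid]
    rw [hSA]
    push_cast
    rw [pow_succ, pow_succ, pow_add]
    field_simp
  set u : ℕ → List Bool := fun n =>
    dyadicBits (2 * A n * 2 ^ l n + 2 ^ E n) (E n + l n + 1) (l n + 1) with hu
  have hub : ∀ n, u n = bits (mid n) (l n + 1) := by
    intro n
    rw [hmidA, bits_dyadic]
    have := (hmem n).2
    rw [hmidA, div_lt_one (by positivity)] at this
    exact_mod_cast this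
  refine ⟨u, ?_, fun m n hmn => ?_, fun n => by rw [hub, length_bits]⟩
  · have hadd := Primrec.nat_add.to_comp
    have hmul := Primrec.nat_mul.to_comp
    have h2A : Computable fun n => 2 * A n := hmul.comp (Computable.const 2) hAc
    have hnum : Computable fun n => 2 * A n * 2 ^ l n + 2 ^ E n :=
      hadd.comp (hmul.comp h2A (hpow hl)) (hpow hEc)
    have hexp : Computable fun n => E n + l n + 1 := Computable.succ.comp (hadd.comp hEc hl)
    have hlen : Computable fun n => l n + 1 := Computable.succ.comp hl
    clear_value A E
    exact (Primrec.to_comp primrec_dyadicBits).comp ((hnum.pair hexp).pair hlen)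
  · have hlen : l m + 1 ≤ l n + 1 := by simpa [hub] using hmn.length_le
    rw [hub, hub] at hmn
    have heq : bits (mid m) (l m + 1) = bits (mid n) (l m + 1) :=
      (List.prefix_of_prefix_length_le hmn (bits_prefix (mid n) hlen) (by simp)).eq_of_length
        (by simp)
    rw [bits_eq_iff (hmem m) (hmem n)] at heq
    -- A common prefix of length `l m + 1` puts the midpoints within `2^(-(l m + 1))`, less than the
    -- distance given by `hsep`.
    have habs := Int.abs_sub_lt_one_of_floor_eq_floor heq
    rw [← mul_sub, abs_mul, abs_of_pos (by positivity : (0 : ℝ) < 2 ^ (l m + 1)),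
      ← lt_inv_mul_iff₀ (by positivity), mul_one, abs_lt] at habs
    by_contra hne
    rcases lt_or_gt_of_ne hne with hlt | hlt
    · linarith [hsep m n hlt, hpos (l n + 1)]
    · linarith [hsep n m hlt, hpos (l n + 1)]

namespace OracleCode

theorem eval_pair (B : Set (List Bool)) (cf cg : OracleCode) (n : ℕ) :
    eval B (pair cf cg) n = (eval B cf n).bind fun u => (eval B cg n).map fun v => Nat.pair u v :=
  rfl

theorem eval_comp (B : Set (List Bool)) (cf cg : OracleCode) (n : ℕ) :
    eval B (comp cf cg) n = (eval B cg n).bind fun y => eval B cf y :=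
  rfl

theorem eval_query (B : Set (List Bool)) (n : ℕ) : eval B query n = Part.some (answer B n) :=
  rfl

theorem answer_encode (B : Set (List Bool)) (s : List Bool) [Decidable (s ∈ B)] :
    answer B (encode s) = if s ∈ B then 1 else 0 := by
  unfold answer
  simp only [encode_inj, exists_eq_right]

/-- A program that queries the strings `h a y` for `y < b a` and lists those in the oracle. -/
theorem exists_collect {h : ℕ → ℕ → List Bool} (hh : Computable₂ h) {b : ℕ → ℕ}
    (hb : Computable b) :
    ∃ c : OracleCode, ∀ B a,
      (∃ L : List (List Bool), eval B c a = Part.some (encode L) ∧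
        ∀ p, p ∈ L ↔ p ∈ B ∧ ∃ y < b a, h a y = p) ∧
      ∀ q, Queries B c a q → ∃ y < b a, q = encode (h a y) := by
  classical
  have h1 : Computable fun z : ℕ => z.unpair.1 := Computable.fst.comp Computable.unpair
  have h2 : Computable fun z : ℕ => z.unpair.2 := Computable.snd.comp Computable.unpair
  obtain ⟨cI, hI, qI⟩ := exists_of_computable (Computable.id (α := ℕ))
  obtain ⟨c0, h0, q0⟩ := exists_of_computable
    (Computable.const (α := ℕ) (encode ([] : List (List Bool))))
  obtain ⟨cB, hB, qB⟩ := exists_of_computable (φ := fun a => Nat.pair a (b a))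
    (Primrec₂.natPair.to_comp.comp Computable.id hb)
  have hH : Computable fun z : ℕ => h z.unpair.1 z.unpair.2.unpair.1 :=
    hh.comp h1 (h1.comp h2)
  obtain ⟨cH, hcH, qH⟩ := exists_of_computable (Computable.encode.comp hH)
  obtain ⟨cS, hcS, qS⟩ := exists_of_computable
    (φ := fun z : ℕ => encode (cond (decide (z.unpair.2 = 1))
      (h z.unpair.1.unpair.1 z.unpair.1.unpair.2.unpair.1 ::
        ((decode z.unpair.1.unpair.2.unpair.2 : Option (List (List Bool))).getD []))
      ((decode z.unpair.1.unpair.2.unpair.2 : Option (List (List Bool))).getD []))) (by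
    have hL : Computable fun z : ℕ =>
        (decode z.unpair.1.unpair.2.unpair.2 : Option (List (List Bool))).getD [] :=
      Computable.option_getD (Computable.decode.comp (h2.comp (h2.comp h1))) (Computable.const [])
    exact Computable.encode.comp (Computable.cond
      (Primrec.eq.decide.to_comp.comp h2 (Computable.const 1))
      (Computable.list_cons.comp (hH.comp h1) hL) hL))
  -- One round of the loop: `cH` produces the string to query, `cI` keeps the current state, and
  -- `cS` adds the string to the list if the answer is 1.
  set cg : OracleCode := comp cS (pair cI (comp query cH)) with hcg
  have hstep : ∀ B a m (L : List (List Bool)),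
      eval B cg (Nat.pair a (Nat.pair m (encode L))) =
        Part.some (encode (if h a m ∈ B then h a m :: L else L)) := by
    intro B a m L
    simp only [hcg, eval_comp, eval_pair, eval_query, hI, hcH, hcS, Part.bind_some, Part.map_some, id, Nat.unpair_pair,
      answer_encode, encodek, Option.getD_some]
    by_cases hm : h a m ∈ B <;> simp [hm]
  have hloop : ∀ B a m, ∃ L : List (List Bool),
      eval B (prec c0 cg) (Nat.pair a m) = Part.some (encode L) ∧
        ∀ p, p ∈ L ↔ p ∈ B ∧ ∃ y < m, h a y = p := by
    intro B a m
    induction m with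
    | zero => exact ⟨[], by rw [eval_prec_zero, h0], by simp⟩
    | succ m ih =>
      obtain ⟨L, hL, hLm⟩ := ih
      refine ⟨if h a m ∈ B then h a m :: L else L, by
        rw [eval_prec_succ, hL, Part.bind_some, hstep], fun p => ?_⟩
      simp only [Nat.lt_succ_iff_lt_or_eq, or_and_right, exists_or, exists_eq_left, and_or_left]
      split_ifs with hm
      · rw [List.mem_cons, hLm, or_comm]
        refine or_congr_right ⟨?_, fun hp => hp.2.symm⟩
        rintro rfl
        exact ⟨hm, rfl⟩
      · rw [hLm]
        refine (or_iff_left ?_).symm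
        rintro ⟨hp, rfl⟩
        exact hm hp
  refine ⟨comp (prec c0 cg) cB, fun B a => ⟨?_, fun q hq => ?_⟩⟩
  · obtain ⟨L, hL, hLm⟩ := hloop B a (b a)
    exact ⟨L, by rw [eval_comp, hB, Part.bind_some, hL], hLm⟩
  · cases hq with
    | comp_inner hq => exact absurd hq (qB _ _ _)
    | comp_outer hy hq =>
      rw [hB, Part.mem_some_iff] at hy
      subst hy
      generalize hz : Nat.pair a (b a) = z at hq
      cases hq with
      | prec_base hq => exact absurd hq (q0 _ _ _)
      | @prec_step _ _ a' n y i _ hy hi hq =>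
        obtain ⟨rfl, rfl⟩ := Nat.pair_eq_pair.1 hz
        rw [hcg] at hq
        cases hq with
        | comp_outer _ hq => exact absurd hq (qS _ _ _)
        | comp_inner hq =>
          cases hq with
          | pair_left hq => exact absurd hq (qI _ _ _)
          | pair_right _ hq =>
            cases hq with
            | comp_inner hq => exact absurd hq (qH _ _ _)
            | comp_outer hy' hq =>
              cases hq
              rw [hcH, Part.mem_some_iff] at hy'
              exact ⟨y, hy, by simpa using hy'⟩

/-- Membership in `A` can be decided within query size `f` if it is partial recursive in the list
of the strings of length at most `f |x|` in the oracle. -/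
theorem reducibleInQuerySize_of_list {f : ℕ → ℕ} (hf : Computable f) {A B : Set (List Bool)}
    {φ : List Bool → List (List Bool) →. Bool} (hφ : Partrec₂ φ)
    (h : ∀ x L, (∀ p, p ∈ L ↔ p ∈ B ∧ p.length ≤ f x.length) →
      ∃ r ∈ φ x L, (r = true ↔ x ∈ A)) :
    ReducibleInQuerySize f A B := by
  have hx : Computable fun a : ℕ => (decode a : Option (List Bool)).getD [] :=
    Computable.option_getD Computable.decode (Computable.const [])
  have hk : Computable fun a : ℕ =>
      stringsUpTo (f ((decode a : Option (List Bool)).getD []).length) :=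
    primrec_stringsUpTo.to_comp.comp (hf.comp (Computable.list_length.comp hx))
  obtain ⟨c, hc⟩ := exists_collect
    (h := fun a y =>
      (stringsUpTo (f ((decode a : Option (List Bool)).getD []).length)).getD y [])
    (b := fun a => (stringsUpTo (f ((decode a : Option (List Bool)).getD []).length)).length)
    ((Primrec.list_getD []).to_comp.comp (hk.comp Computable.fst) Computable.snd)
    (Computable.list_length.comp hk)
  have hψ : Partrec fun z : ℕ => (φ ((decode z.unpair.1 : Option (List Bool)).getD [])
      ((decode z.unpair.2 : Option (List (List Bool))).getD [])).map fun r => cond r 1 0 := by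
    have h1 : Computable fun z : ℕ => z.unpair.1 := Computable.fst.comp Computable.unpair
    have h2 : Computable fun z : ℕ => z.unpair.2 := Computable.snd.comp Computable.unpair
    exact Partrec.map (hφ.comp (hx.comp h1) (Computable.option_getD (Computable.decode.comp h2)
      (Computable.const []))) (Computable.cond Computable.snd (Computable.const 1)
        (Computable.const 0))
  obtain ⟨cI, hI, qI⟩ := exists_of_computable (Computable.id (α := ℕ))
  obtain ⟨cψ, hcψ, qψ⟩ := exists_of_partrec (Partrec.nat_iff.1 hψ)
  refine ⟨comp cψ (pair cI c), fun x => ?_, fun x q hq => ?_⟩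
  · obtain ⟨⟨L, hL, hLm⟩, -⟩ := hc B (encode x)
    obtain ⟨r, hr, hrA⟩ := h x L fun p => by
      rw [hLm]
      refine and_congr_right fun _ => ?_
      simp only [encodek, Option.getD_some]
      rw [← mem_stringsUpTo, List.mem_iff_getElem]
      constructor
      · rintro ⟨y, hy, he⟩
        exact ⟨y, hy, by rw [← he, List.getD_eq_getElem _ _ hy]⟩
      · rintro ⟨y, hy, he⟩
        exact ⟨y, hy, by rw [← he, List.getD_eq_getElem _ _ hy]⟩
    have hev : cond r 1 0 ∈ eval B (comp cψ (pair cI c)) (encode x) := by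
      simp only [eval_comp, eval_pair, hI, hL, hcψ, Part.bind_some, Part.map_some, id, Nat.unpair_pair, encodek,
        Option.getD_some]
      exact Part.mem_map _ hr
    refine ⟨fun hA => ?_, fun hA => ?_⟩
    · rw [hrA.2 hA] at hev
      exact hev
    · rw [Bool.eq_false_iff.2 fun hrt => hA (hrA.1 hrt)] at hev
      exact hev
  · cases hq with
    | comp_outer _ hq => exact absurd hq (qψ _ _ _)
    | comp_inner hq =>
      cases hq with
      | pair_left hq => exact absurd hq (qI _ _ _)
      | pair_right _ hq =>
        obtain ⟨y, hy, rfl⟩ := (hc B (encode x)).2 q hq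
        refine ⟨_, rfl, ?_⟩
        simp only [encodek, Option.getD_some] at hy ⊢
        rw [List.getD_eq_getElem _ _ hy, ← mem_stringsUpTo]
        exact List.getElem_mem _

end OracleCode

theorem reducible_of_summable {V W : List Bool →. List Bool} (hV : OptimalPrefixFreeMachine V)
    (hW : OptimalPrefixFreeMachine W) {f : ℕ → ℕ} (hf : Computable f)
    (hs : Summable fun n : ℕ => (2 : ℝ) ^ n * (2 ^ f n)⁻¹) :
    ∃ c, ReducibleInQuerySize (fun n => f n + c) (Pf (Omega V)) W.Dom := by
  obtain ⟨GV, hGV⟩ := exists_stageApprox hV.partrec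
  obtain ⟨GW, hGW⟩ := exists_stageApprox hW.partrec
  obtain ⟨d, hd⟩ := pow_unbounded_of_one_lt (∑' n : ℕ, (2 : ℝ) ^ n * (2 ^ f n)⁻¹) one_lt_two
  -- Each single term is at most `2 ^ d`, so the subtraction in the code lengths `f n + d - n` is
  -- not truncated.
  have hle : ∀ n, n ≤ f n + d := by
    intro n
    have h1 := (hs.le_tsum n fun _ _ => by positivity).trans hd.le
    rw [mul_inv_le_iff₀ (by positivity), ← pow_add] at h1
    have := (pow_le_pow_iff_right₀ (one_lt_two (α := ℝ))).1 h1
    omega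
  have hlc : Computable fun n => f n + d - n :=
    Primrec.nat_sub.to_comp.comp (Primrec.nat_add.to_comp.comp hf (Computable.const d))
      Computable.id
  obtain ⟨u, huc, hup, hul⟩ := exists_prefix_code hlc fun n => by
    have h1 : ∑ k ∈ Finset.range n, ((2 : ℝ) ^ (f k + d - k))⁻¹ =
        (∑ k ∈ Finset.range n, (2 : ℝ) ^ k * (2 ^ f k)⁻¹) * (2 ^ d)⁻¹ := by
      rw [Finset.sum_mul]
      refine Finset.sum_congr rfl fun k _ => ?_
      rw [pow_sub₀ _ two_ne_zero (hle k), pow_add]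
      field_simp
    rw [h1, mul_inv_le_iff₀ (by positivity), one_mul]
    exact (hs.sum_le_tsum _ fun _ _ => by positivity).trans hd.le
  -- The stage is printed in unary so that a bound on output lengths bounds the stage.
  set g : ℕ → List Bool →. List Bool := fun n v =>
    (Nat.rfind fun s => Part.some (decide (omegaBits GV s n = v))).map
      fun s => List.replicate s true with hg
  have hgc : Partrec₂ g := by
    refine Partrec.map (Partrec.rfind (Computable.partrec ?_))
      ((primrec_replicate true).to_comp.comp Computable.snd)
    exact Primrec.eq.decide.to_comp.comp ((primrec_omegaBits hGV.primrec).to_comp.comp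
      Computable.snd (Computable.fst.comp Computable.fst)) (Computable.snd.comp Computable.fst)
  obtain ⟨F, hF, hFg⟩ := exists_tagged_machine huc hup Computable.id hgc
  obtain ⟨e, he⟩ := hW.optimal F hF
  -- The tag has length `f n + d - n + 1` and its argument length `n`; simulation by `W` adds `e`.
  refine ⟨d + 1 + e, ?_⟩
  -- the stage by which all programs in `L` have halted with outputs that are not longer
  set stage : List (List Bool) →. ℕ := fun L => Nat.rfind fun t => Part.some
    (L.all fun q => ((GW t q).map fun y => decide (y.length ≤ t)).getD false) with hstage
  have hstagec : Partrec stage := by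
    refine Partrec.rfind (Computable.partrec (Primrec.to_comp ?_))
    refine primrec_all Primrec.fst ?_
    exact Primrec.option_getD.comp (Primrec.option_map (hGW.primrec.comp
      (Primrec.snd.comp Primrec.fst) Primrec.snd) (Primrec.nat_le.decide.comp
        (Primrec.list_length.comp Primrec.snd)
        (Primrec.snd.comp (Primrec.fst.comp Primrec.fst)))) (Primrec.const false)
  have hok : ∀ (L : List (List Bool)) t,
      (L.all fun q => ((GW t q).map fun y => decide (y.length ≤ t)).getD false) = true ↔
        ∀ q ∈ L, ∃ y ∈ GW t q, y.length ≤ t := by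
    intro L t
    rw [List.all_eq_true]
    refine forall₂_congr fun q _ => ?_
    cases GW t q <;> simp
  refine OracleCode.reducibleInQuerySize_of_list
    (φ := fun x L => (stage L).map fun t => decide (x = omegaBits GV t x.length))
    (Primrec.nat_add.to_comp.comp hf (Computable.const _)) ?_ fun x L hL => ?_
  · refine Partrec.map (hstagec.comp Computable.snd) ?_
    have hx : Computable fun z : (List Bool × List (List Bool)) × ℕ => z.1.1 :=
      Computable.fst.comp Computable.fst
    exact Primrec.eq.decide.to_comp.comp hx ((primrec_omegaBits hGV.primrec).to_comp.comp
      Computable.snd (Computable.list_length.comp hx))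
  · set n := x.length with hn
    have hev : ∀ q ∈ L.toFinset, ∀ᶠ t in atTop, ∃ y ∈ GW t q, y.length ≤ t := by
      intro q hq
      obtain ⟨y, hy⟩ := (PFun.mem_dom _ _).1 ((hL q).1 (List.mem_toFinset.1 hq)).1
      obtain ⟨t₀, ht₀⟩ := hGW.mem_iff.1 hy
      filter_upwards [eventually_ge_atTop t₀, eventually_ge_atTop y.length] with t h1 h2
      exact ⟨y, hGW.mono h1 ht₀, h2⟩
    obtain ⟨t₁, ht₁⟩ := ((eventually_all_finset _).2 hev).exists
    obtain ⟨t, ht, -⟩ := Nat.rfind_min'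
      (p := fun t => L.all fun q => ((GW t q).map fun y => decide (y.length ≤ t)).getD false)
      ((hok L t₁).2 fun q hq => ht₁ q (List.mem_toFinset.2 hq))
    have htL := (hok L t).1 (Part.mem_some_iff.1 (Nat.rfind_spec ht)).symm
    obtain ⟨s₀, hs₀⟩ := hV.exists_omegaBits_eq_bits hGV n
    obtain ⟨s, hsf, -⟩ := Nat.rfind_min'
      (p := fun s => decide (omegaBits GV s n = bits (Omega V) n)) (decide_eq_true hs₀)
    have hsb := of_decide_eq_true (Part.mem_some_iff.1 (Nat.rfind_spec hsf)).symm
    obtain ⟨q, hq, hqlen⟩ := he _ _ (hFg n (bits (Omega V) n) _ (by simp)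
      (Part.mem_map (fun s => List.replicate s true) hsf))
    have hqL : q ∈ L := by
      refine (hL q).2 ⟨(PFun.mem_dom _ _).2 ⟨_, hq⟩, hqlen.trans ?_⟩
      rw [List.length_append, hul, length_bits]
      have := hle n
      omega
    -- The list contains a program printing a correct stage `s` in unary, so `s ≤ t`, and the bits
    -- at stage `t` are correct too.
    obtain ⟨y, hy, hyt⟩ := htL q hqL
    have hys := Part.mem_unique (hGW.mem_iff.2 ⟨t, hy⟩) hq
    rw [hys, List.length_replicate] at hyt
    refine ⟨_, Part.mem_map _ ht, ?_⟩
    rw [decide_eq_true_iff, hV.omegaBits_eq_bits_mono hGV hyt hsb, mem_Pf_iff]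

end QuerySize

theorem theorem4p1 (V W : List Bool →. List Bool)
    (hV : QuerySize.OptimalPrefixFreeMachine V) (hW : QuerySize.OptimalPrefixFreeMachine W)
    (f : ℕ → ℕ) (hf : QuerySize.OrderFunction f) :
    (∃ c : ℕ, QuerySize.ReducibleInQuerySize (fun n => f n + c)
        (QuerySize.Pf (QuerySize.Omega V)) W.Dom) ↔
      Summable (fun n : ℕ => (2 : ℝ) ^ ((n : ℤ) - (f n : ℤ))) := by
  have heq : (fun n : ℕ => (2 : ℝ) ^ ((n : ℤ) - (f n : ℤ))) =
      fun n : ℕ => (2 : ℝ) ^ n * (2 ^ f n)⁻¹ := by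
    funext n
    rw [zpow_sub₀ two_ne_zero, zpow_natCast, zpow_natCast, div_eq_mul_inv]
  rw [heq]
  constructor
  · rintro ⟨c, hc⟩
    have h := QuerySize.summable_of_reducible hV hW.toPrefixFreeMachine
      (hf.monotone.add_const c)
      (Primrec.nat_add.to_comp.comp hf.computable (Computable.const c)) hc
    refine (h.mul_right (2 ^ c)).congr fun n => ?_
    rw [pow_add]
    field_simp
  · exact QuerySize.reducible_of_summable hV hW hf.computable
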